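/- Elections: a vote over a set of $m \ge 1$ candidates is a linear order. For a profile $V$ of votes let $D_V(x,y)$ be the number of votes in $V$ preferring $x$ to $y$ minus the number preferring $y$ to $x$. The Copeland score of $x$ is the number of candidates $y \ne x$ with $D_V(x,y) > 0$, and the Copeland winners are the candidates with maximum score. An instance of Coalitional Manipulation for Copeland consists of a set $\mathcal C$ of $m$ candidates, a distinguished candidate $c$, a list $V$ of votes (of the non-manipulators) and a set $M$ of manipulators (whose votes are empty), with at least one voter in total, $|V| + |M| \ge 1$. It is a yes-instance if the manipulators can cast votes such that $c$ is the unique Copeland winner of the resulting election. An instance is written as a string over a finite alphabet by listing the number of candidates, $c$ and all votes; the parameter is $k = m$. For a polynomial $p$ with natural-number coefficients, let $\Pi_p$ be the parameterized problem consisting of the pairs $(x,m)$ where $x$ describes a yes-instance with $m$ candidates and $|M| \le p(m)$. Theorem. There is an absolute constant $C$ such that for every polynomial $p$ the problem $\Pi_p$ (Coalitional Manipulation for Copeland, parameterized by the number $m$ of candidates, with at most $p(m)$ manipulators) admits a polynomial kernel: there is an algorithm that, given any string $x$ and any $k \in \mathbb N$, runs in time polynomial in $|x| + k$ and outputs a pair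 $(x',k')$ such that $(x,k) \in \Pi_p$ if and only if $(x',k') \in \Pi_p$, and $|x'|, k' \le g(k)$ for some polynomial $g$ (depending on $p$). Moreover, whenever $x$ describes an instance $(\mathcal C, c, V, M)$ with $m$ candidates and $|M| \le p(m)$ and $k = m$, the output describes an instance $(\mathcal C, c, V', M')$ with the same $m$ candidates, the same distinguished candidate and the same number $|M'| = |M|$ of manipulators, such that: (i) for all candidates $a, b$: if $D_V(a,b) > |M|$, then $D_{V'}(a,b)$ is the one of $|M|+1$ and $|M|+2$ that has the same parity as $D_V(a,b)$ (and $D_{V'}(b,a) = -D_{V'}(a,b)$), while $D_{V'}(a,b) = D_V(a,b)$ if $|D_V(a,b)| \le |M|$; (ii) the output instance has at most $C\, m^2 \max(1,|M|)$ votes in total; in particular $O(m^2 |M|)$ votes when $|M| \ge 1$. -/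

import Mathlib

/-! ### Parameterized problems and polynomial kernels -/

/-- A parameterized problem over the alphabet `Γ`: a set of pairs `(x, k)` of a string and a
parameter. -/
abbrev ParamProblem (Γ : Type) : Type := Set (List Γ × ℕ)

/-- How a pair `(x, k)` is handed to a machine: the symbols of `x`, followed by `k` tally marks.
The length of the code is exactly `|x| + k`. -/
def pairEncoding (Γ : Type) : Computability.Encoding (List Γ × ℕ) (Γ ⊕ Bool) :=
  Computability.encodingProd (Computability.encodingList Γ) Computability.unaryEncodingNat

theorem length_pairEncoding {Γ : Type} (q : List Γ × ℕ) :
    ((pairEncoding Γ).encode q).length = q.1.length + q.2 := by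
  have h : ∀ n : ℕ, (Computability.unaryEncodeNat n).length = n :=
    Computability.unary_decode_encode_nat
  simp [pairEncoding, Computability.encodingProd, Computability.encodingList,
    Computability.unaryEncodingNat, h]

/-- `f` is a kernelization algorithm of polynomial size for the parameterized problem `P`:
it is computed by a Turing machine in time polynomial in `|x| + k`, it maps yes-instances to
yes-instances and no-instances to no-instances, and for some polynomial `g` the string and the
parameter of the output are both at most `g k`. -/
structure IsPolynomialKernelization {Γ : Type} [Fintype Γ] (P : ParamProblem Γ)
    (f : List Γ × ℕ → List Γ × ℕ) : Prop where
  polyTime : Nonempty (Turing.TM2ComputableInPolyTime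
    (pairEncoding Γ).encode (pairEncoding Γ).encode f)
  equivalent : ∀ q : List Γ × ℕ, q ∈ P ↔ f q ∈ P
  size : ∃ g : Polynomial ℕ, ∀ (x : List Γ) (k : ℕ),
    (f (x, k)).1.length ≤ g.eval k ∧ (f (x, k)).2 ≤ g.eval k

/-! ### Elections and the Copeland rule -/

/-- A vote over `m` candidates: a linear order, given by the bijection that sends a position
(`0` is the most preferred one) to the candidate in that position. -/
abbrev Vote (m : ℕ) : Type := Equiv.Perm (Fin m)

/-- The vote `v` strictly prefers `x` to `y`. -/
def Vote.Prefers {m : ℕ} (v : Vote m) (x y : Fin m) : Prop := v.symm x < v.symm y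

instance {m : ℕ} (v : Vote m) (x y : Fin m) : Decidable (v.Prefers x y) :=
  inferInstanceAs (Decidable (v.symm x < v.symm y))

/-- `N(x, y)`: the number of votes in the profile `V` that prefer `x` to `y`. -/
def numPrefer {m : ℕ} (V : List (Vote m)) (x y : Fin m) : ℕ :=
  V.countP fun v => decide (v.Prefers x y)

/-- `D(x, y) = N(x, y) - N(y, x)`: the weight of the edge `(x, y)` in the weighted majority
graph of the profile `V`. -/
def margin {m : ℕ} (V : List (Vote m)) (x y : Fin m) : ℤ :=
  (numPrefer V x y : ℤ) - (numPrefer V y x : ℤ)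

/-- The Copeland score of `x`: the number of candidates `y ≠ x` with `D(x, y) > 0`. -/
def copelandScore {m : ℕ} (V : List (Vote m)) (x : Fin m) : ℕ :=
  (Finset.univ.filter fun y : Fin m => y ≠ x ∧ 0 < margin V x y).card

/-- The Copeland winners: the candidates with maximum Copeland score. -/
def copelandWinners {m : ℕ} (V : List (Vote m)) : Finset (Fin m) :=
  Finset.univ.filter fun x => ∀ y, copelandScore V y ≤ copelandScore V x

/-! ### Coalitional manipulation -/

/-- An instance of Coalitional Manipulation with `m` candidates: the candidate the manipulators
want to win, the votes of the non-manipulators, and the number of manipulators. There is at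
least one voter. -/
structure CMInstance (m : ℕ) where
  target : Fin m
  votes : List (Vote m)
  manipulators : ℕ
  voters_pos : 0 < votes.length + manipulators

/-- The total number of votes (of non-manipulators and of manipulators) of an instance. -/
def CMInstance.numVotes {m : ℕ} (I : CMInstance m) : ℕ := I.votes.length + I.manipulators

/-- The manipulators can vote so that the target is the unique Copeland winner. -/
def CMInstance.IsYes {m : ℕ} (I : CMInstance m) : Prop :=
  ∃ W : List (Vote m), W.length = I.manipulators ∧ copelandWinners (I.votes ++ W) = {I.target}

/-- The alphabet in which instances are written. -/
inductive CMSym where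
  | tick
  | comma
  | semicolon
  deriving DecidableEq

instance : Fintype CMSym :=
  ⟨{CMSym.tick, CMSym.comma, CMSym.semicolon}, fun a => by cases a <;> simp⟩

/-- A list of numbers: each number in unary, followed by a comma; a semicolon at the end. -/
def encodeRow (l : List ℕ) : List CMSym :=
  (l.flatMap fun a => List.replicate a CMSym.tick ++ [CMSym.comma]) ++ [CMSym.semicolon]

/-- The string that describes an instance: the number of candidates and the target, then one
row for each vote. The row of a non-manipulator lists the candidates `0, …, m - 1` from the most
to the least preferred one; the row of a manipulator is empty (the empty vote). -/
def CMInstance.encode {m : ℕ} (I : CMInstance m) : List CMSym :=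
  encodeRow [m, (I.target : ℕ)] ++
    (I.votes.flatMap fun v => encodeRow (List.ofFn fun i => (v i : ℕ))) ++
    (List.replicate I.manipulators (encodeRow [])).flatten

/-- Coalitional Manipulation for the Copeland rule, parameterized by the number of candidates,
when the number of manipulators is at most `p m`, where `m` is the number of candidates. -/
def CopelandCM (p : Polynomial ℕ) : ParamProblem CMSym :=
  {q | ∃ I : CMInstance q.2, I.encode = q.1 ∧ I.manipulators ≤ p.eval q.2 ∧ I.IsYes}

/-- The capped weight for `t` manipulators: a weight `w > t` becomes `t + 1` or `t + 2`, whichever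
has the parity of `w`; the weight of a reversed edge is the negative; other weights are kept. -/
def capWeight (t : ℕ) (w : ℤ) : ℤ :=
  if (t : ℤ) < w then (if Even (w - (t + 1)) then (t : ℤ) + 1 else (t : ℤ) + 2)
  else if w < -(t : ℤ) then (if Even (w + (t + 1)) then -((t : ℤ) + 1) else -((t : ℤ) + 2))
  else w

/-! The Copeland winners depend only on which margins are positive, and `t` manipulators change each
margin by at most `t`. A margin of absolute value above `t` therefore has a fixed sign whatever the
manipulators do. It may be replaced by the least value above `t` of the same parity, with the same
sign, while the other margins are kept (`CMInstance.isYes_reduce`).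

The capped margins are realized by McGarvey's construction. All margins between distinct candidates
have the parity of the number of votes, so a base of one vote (odd case) or two opposite votes (even
case) settles the parity. For each ordered pair `(a, b)`, two votes that agree in opposite
directions on everything but `{a, b}` add `2` to the margin of `a` over `b` and leave unrelated
margins alone (`margin_pairVotes`). Each weight is at most `t + 2`, so each ordered pair needs at
most `t + 3` votes (`margin_reducedVotes`, `CMInstance.numVotes_reduce_le`). With at most `p m`
manipulators, the encoding then has length polynomial in `m`.

Polynomial running time is proved on an actual Turing machine. Stack programs are compiled with an
exact step count (`code_simulates`), and words built by bounded loops are emitted by such programs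
in polynomial time (`Emit.polyEmits`). The kernel is written as a word of this kind: instances are
parsed by counting separators, malformed input is recognized by encoding the decoded data again and
comparing, and the reduced votes are printed by loops over pairs (`Emit.kernelWord`,
`encode_kernelize`). -/

/-! ### A while language on stacks and its compilation to Turing machines -/

namespace StackProgram

open Turing Function

/-- Programs acting on a family of stacks indexed by `ℕ`. -/
inductive Cmd (Γ : Type) : Type
  | skip
  | push (k : ℕ) (a : Γ)
  | pop (k : ℕ)
  | move (k l : ℕ)
  | seq (c d : Cmd Γ)
  | ite (k l : ℕ) (p : Option Γ → Option Γ → Bool) (c d : Cmd Γ)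
  | loop (k : ℕ) (c : Cmd Γ)

/-- The contents of the stacks. -/
abbrev Store (Γ : Type) : Type := ℕ → List Γ

variable {Γ : Type}

/-- Move the top symbol of the stack `k`, if there is one, to the stack `l`. -/
def Store.move (s : Store Γ) (k l : ℕ) : Store Γ :=
  match (s k).head? with
  | none => s
  | some a => update (update s k (s k).tail) l (a :: update s k (s k).tail l)

/-- `Exec c s s' n`: the program `c` turns the store `s` into `s'` in exactly `n` steps. -/
inductive Exec : Cmd Γ → Store Γ → Store Γ → ℕ → Prop
  | skip (s) : Exec .skip s s 1
  | push (s k a) : Exec (.push k a) s (update s k (a :: s k)) 1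
  | pop (s k) : Exec (.pop k) s (update s k (s k).tail) 1
  | move (s k l) : Exec (.move k l) s (s.move k l) 1
  | seq {c d s s' s'' m n} : Exec c s s' m → Exec d s' s'' n → Exec (.seq c d) s s'' (m + n)
  | iteTrue {k l p c d s s' n} : p (s k).head? (s l).head? = true → Exec c s s' n →
      Exec (.ite k l p c d) s s' (1 + n)
  | iteFalse {k l p c d s s' n} : p (s k).head? (s l).head? = false → Exec d s s' n →
      Exec (.ite k l p c d) s s' (1 + n)
  | loopDone {k c s} : s k = [] → Exec (.loop k c) s s 1
  | loopStep {k c s s' s'' m n} : s k ≠ [] → Exec c s s' m → Exec (.loop k c) s' s'' n →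
      Exec (.loop k c) s s'' (1 + m + n)

namespace Cmd

/-- An upper bound on the stacks a program mentions. -/
def maxReg : Cmd Γ → ℕ
  | skip => 0
  | push k _ => k
  | pop k => k
  | move k l => max k l
  | seq c d => max c.maxReg d.maxReg
  | ite k l _ c d => max (max k l) (max c.maxReg d.maxReg)
  | loop k c => max k c.maxReg

/-- The labels of the machine that executes a program. -/
def Lab : Cmd Γ → Type
  | skip => Unit
  | push _ _ => Unit
  | pop _ => Unit
  | move _ _ => Unit
  | seq c d => c.Lab ⊕ d.Lab
  | ite _ _ _ c d => Option (c.Lab ⊕ d.Lab)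
  | loop _ c => Option c.Lab

instance fintypeLab : (c : Cmd Γ) → Fintype c.Lab
  | skip => inferInstanceAs (Fintype Unit)
  | push _ _ => inferInstanceAs (Fintype Unit)
  | pop _ => inferInstanceAs (Fintype Unit)
  | move _ _ => inferInstanceAs (Fintype Unit)
  | seq c d =>
    haveI := fintypeLab c
    haveI := fintypeLab d
    inferInstanceAs (Fintype (c.Lab ⊕ d.Lab))
  | ite _ _ _ c d =>
    haveI := fintypeLab c
    haveI := fintypeLab d
    inferInstanceAs (Fintype (Option (c.Lab ⊕ d.Lab)))
  | loop _ c =>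
    haveI := fintypeLab c
    inferInstanceAs (Fintype (Option c.Lab))

/-- The label at which the execution of a program starts. -/
def entry : (c : Cmd Γ) → c.Lab
  | skip => ()
  | push _ _ => ()
  | pop _ => ()
  | move _ _ => ()
  | seq c _ => Sum.inl c.entry
  | ite _ _ _ _ _ => (none : Option _)
  | loop _ _ => (none : Option _)

/-- The stack `k` as an element of `Fin (N + 1)`; meaningful only for `k ≤ N`. -/
def stack (N k : ℕ) : Fin (N + 1) := Fin.ofNat (N + 1) k

theorem stack_eq_iff {N k : ℕ} (h : k ≤ N) (i : Fin (N + 1)) : i = stack N k ↔ (i : ℕ) = k := by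
  rw [Fin.ext_iff]
  simp [stack, Nat.mod_eq_of_lt (Nat.lt_succ_of_le h)]

/-- The statement that jumps to the label `l` after clearing the internal state. -/
def jump {N : ℕ} {Λ : Type} (l : Λ) :
    TM2.Stmt (fun _ : Fin (N + 1) => Γ) Λ (Option Γ × Option Γ) :=
  .load (fun _ => (none, none)) (.goto fun _ => l)

/-- The code of a program, as part of a machine with labels `Λ`: the labels of the program are
embedded by `inj`, and the label `exit` follows the program. The symbol `u` is arbitrary. -/
def code (u : Γ) (N : ℕ) {Λ : Type} : (c : Cmd Γ) → (c.Lab → Λ) → Λ → c.Lab →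
    TM2.Stmt (fun _ : Fin (N + 1) => Γ) Λ (Option Γ × Option Γ)
  | skip, _, exit, _ => jump exit
  | push k a, _, exit, _ => .push (stack N k) (fun _ => a) (jump exit)
  | pop k, _, exit, _ => .pop (stack N k) (fun v _ => v) (jump exit)
  | move k l, _, exit, _ =>
      .pop (stack N k) (fun _ o => (o, none)) <|
        .branch (fun v => v.1.isSome)
          (.push (stack N l) (fun v => v.1.getD u) (jump exit)) (jump exit)
  | seq c d, inj, exit, l =>
      match l with
      | Sum.inl l => code u N c (fun l => inj (Sum.inl l)) (inj (Sum.inr d.entry)) l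
      | Sum.inr l => code u N d (fun l => inj (Sum.inr l)) exit l
  | ite k l p c d, inj, exit, l' =>
      match l' with
      | none =>
        .peek (stack N k) (fun _ o => (o, none)) <|
          .peek (stack N l) (fun v o => (v.1, o)) <|
            .branch (fun v => p v.1 v.2) (jump (inj (some (Sum.inl c.entry))))
              (jump (inj (some (Sum.inr d.entry))))
      | some (Sum.inl l) => code u N c (fun l => inj (some (Sum.inl l))) exit l
      | some (Sum.inr l) => code u N d (fun l => inj (some (Sum.inr l))) exit l
  | loop k c, inj, exit, l =>
      match l with
      | none =>
        .peek (stack N k) (fun _ o => (o, none)) <|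
          .branch (fun v => v.1.isSome) (jump (inj (some c.entry))) (jump exit)
      | some l => code u N c (fun l => inj (some l)) (inj none) l

end Cmd

/-! ### Correctness of the compilation. -/

/-- The first `N + 1` stacks. -/
def Store.restrict (s : Store Γ) (N : ℕ) : Fin (N + 1) → List Γ := fun i => s i

theorem Store.restrict_stack (s : Store Γ) {N k : ℕ} (h : k ≤ N) :
    s.restrict N (Cmd.stack N k) = s k :=
  congrArg s ((Cmd.stack_eq_iff h _).1 rfl)

theorem Store.restrict_update (s : Store Γ) {N k : ℕ} (h : k ≤ N) (l : List Γ) :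
    update (s.restrict N) (Cmd.stack N k) l = Store.restrict (update s k l) N := by
  funext i
  by_cases hi : (i : ℕ) = k
  · rw [(Cmd.stack_eq_iff h i).2 hi, update_self]
    simp [restrict, (Cmd.stack_eq_iff h _).1 rfl]
  · rw [update_of_ne (mt (Cmd.stack_eq_iff h i).1 hi)]
    simp [restrict, update_of_ne hi]

theorem step_iterate {N : ℕ} {Λ : Type}
    {M : Λ → TM2.Stmt (fun _ : Fin (N + 1) => Γ) Λ (Option Γ × Option Γ)}
    {a b c : TM2.Cfg (fun _ : Fin (N + 1) => Γ) Λ (Option Γ × Option Γ)} {m n : ℕ}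
    (h₁ : (flip bind (TM2.step M))^[m] (some a) = some b)
    (h₂ : (flip bind (TM2.step M))^[n] (some b) = some c) :
    (flip bind (TM2.step M))^[m + n] (some a) = some c := by
  rw [Nat.add_comm m n, iterate_add_apply, h₁, h₂]

/-- The compiled code of a program simulates the program, step by step. -/
theorem code_simulates (u : Γ) (N : ℕ) {Λ : Type}
    (M : Λ → TM2.Stmt (fun _ : Fin (N + 1) => Γ) Λ (Option Γ × Option Γ))
    {c : Cmd Γ} {s s' : Store Γ} {n : ℕ} (h : Exec c s s' n) :
    ∀ (inj : c.Lab → Λ) (exit : Λ), c.maxReg ≤ N →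
      (∀ l, M (inj l) = c.code u N inj exit l) →
      (flip bind (TM2.step M))^[n] (some ⟨some (inj c.entry), (none, none), s.restrict N⟩) =
        some ⟨some exit, (none, none), s'.restrict N⟩ := by
  induction h with
  | skip s =>
    intro inj exit hN hM
    simp [flip, hM, Cmd.code, Cmd.jump]
  | push s k a =>
    intro inj exit hN hM
    replace hN : k ≤ N := hN
    simp [flip, hM, Cmd.code, Cmd.jump, s.restrict_stack hN, s.restrict_update hN]
  | pop s k =>
    intro inj exit hN hM
    replace hN : k ≤ N := hN
    simp [flip, hM, Cmd.code, Cmd.jump, s.restrict_stack hN, s.restrict_update hN]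
  | move s k l =>
    intro inj exit hN hM
    have hk : k ≤ N := (le_max_left _ _).trans hN
    have hl : l ≤ N := (le_max_right _ _).trans hN
    cases hs : s k with
    | nil =>
      simp [flip, hM, Cmd.code, Cmd.jump, s.restrict_stack hk, s.restrict_update hk, Store.move, hs]
      rw [← hs, update_eq_self]
    | cons a t =>
      simp [flip, hM, Cmd.code, Cmd.jump, s.restrict_stack hk, s.restrict_update hk, Store.move, hs,
        Store.restrict_stack _ hl, Store.restrict_update _ hl]
  | @seq c d s s' s'' m n h₁ h₂ ih₁ ih₂ =>
    intro inj exit hN hM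
    have := ih₁ (fun l => inj (Sum.inl l)) (inj (Sum.inr d.entry)) ((le_max_left _ _).trans hN)
      (fun l => hM (Sum.inl l))
    exact step_iterate this <| ih₂ (fun l => inj (Sum.inr l)) exit ((le_max_right _ _).trans hN)
      (fun l => hM (Sum.inr l))
  | @iteTrue k l p c d s s' n hp h₁ ih₁ =>
    intro inj exit hN hM
    simp only [Cmd.maxReg, max_le_iff] at hN
    refine step_iterate (b := ⟨some (inj (some (Sum.inl c.entry))), (none, none), s.restrict N⟩)
      ?_ (ih₁ (fun l => inj (some (Sum.inl l))) exit hN.2.1 (fun l => hM (some (Sum.inl l))))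
    have := hM none
    simp [flip, Cmd.entry, this, Cmd.code, Cmd.jump, s.restrict_stack hN.1.1,
      s.restrict_stack hN.1.2, hp]
  | @iteFalse k l p c d s s' n hp h₁ ih₁ =>
    intro inj exit hN hM
    simp only [Cmd.maxReg, max_le_iff] at hN
    refine step_iterate (b := ⟨some (inj (some (Sum.inr d.entry))), (none, none), s.restrict N⟩)
      ?_ (ih₁ (fun l => inj (some (Sum.inr l))) exit hN.2.2 (fun l => hM (some (Sum.inr l))))
    have := hM none
    simp [flip, Cmd.entry, this, Cmd.code, Cmd.jump, s.restrict_stack hN.1.1,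
      s.restrict_stack hN.1.2, hp]
  | @loopDone k c s hs =>
    intro inj exit hN hM
    simp only [Cmd.maxReg, max_le_iff] at hN
    have := hM none
    simp [flip, Cmd.entry, this, Cmd.code, Cmd.jump, s.restrict_stack hN.1, hs]
  | @loopStep k c s s' s'' m n hs h₁ h₂ ih₁ ih₂ =>
    intro inj exit hN hM
    have hN' := hN
    simp only [Cmd.maxReg, max_le_iff] at hN'
    -- The body is compiled with the loop head `inj none` as its exit, so the test, the body and the
    -- rest of the loop are three consecutive runs.
    refine step_iterate (step_iterate
      (b := ⟨some (inj (some c.entry)), (none, none), s.restrict N⟩) ?_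
      (ih₁ (fun l => inj (some l)) (inj none) hN'.2 (fun l => hM (some l)))) (ih₂ inj exit hN hM)
    have := hM none
    simp [flip, Cmd.entry, this, Cmd.code, Cmd.jump, s.restrict_stack hN'.1,
      List.isSome_head?.2 hs]

/-- The machine that executes a program with input on the stack `0` and output on the
stack `1`. -/
def machine [Fintype Γ] (u : Γ) (c : Cmd Γ) : FinTM2 where
  K := Fin (max c.maxReg 1 + 1)
  k₀ := Cmd.stack _ 0
  k₁ := Cmd.stack _ 1
  Γ _ := Γ
  Λ := Option c.Lab
  main := some c.entry
  σ := Option Γ × Option Γ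
  initialState := (none, none)
  m
    | none => .halt
    | some l => c.code u _ some none l

/-- Transport of a run of a machine along equalities of its input and of its output. -/
def outputsInTime_congr {tm : FinTM2} {l₁ l₂ : List (tm.Γ tm.k₀)}
    {o₁ o₂ : Option (List (tm.Γ tm.k₁))} {n : ℕ} (hl : l₁ = l₂) (ho : o₁ = o₂)
    (h : TM2OutputsInTime tm l₁ o₁ n) : TM2OutputsInTime tm l₂ o₂ n :=
  hl ▸ ho ▸ h

/-- A function computed by a program within a polynomial number of steps is computed by a Turing
machine in polynomial time. -/
theorem polyTime_of_exec [Fintype Γ] (u : Γ) {α β : Type} (ea : α → List Γ) (eb : β → List Γ)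
    (f : α → β) (c : Cmd Γ) (P : Polynomial ℕ)
    (h : ∀ a, ∃ n ≤ P.eval (ea a).length,
      Exec c (update (fun _ => []) 0 (ea a)) (update (fun _ => []) 1 (eb (f a))) n) :
    Nonempty (TM2ComputableInPolyTime ea eb f) := by
  -- The extra `1` in the time bound pays for the `halt` at the exit label `none`.
  refine ⟨{ tm := machine u c, inputAlphabet := Equiv.refl _, outputAlphabet := Equiv.refl _,
            time := P + 1, outputsFun := fun a => ?_ }⟩
  choose n hn hexec using h
  have hsim := code_simulates u (max c.maxReg 1) (machine u c).m (hexec a) some none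
    (le_max_left _ _) (fun l => rfl)
  have h0 : Store.restrict (update (fun _ => []) 0 (ea a)) (max c.maxReg 1) =
      (initList (machine u c) (ea a)).stk := by
    rw [← Store.restrict_update _ (Nat.zero_le _)]
    funext i
    by_cases hi : i = (machine u c).k₀
    · subst hi
      simp only [initList, dif_pos]
      exact update_self _ _ _
    · have : (initList (machine u c) (ea a)).stk i = [] := dif_neg hi
      exact (update_of_ne hi _ _).trans this.symm
  have h1 : Store.restrict (update (fun _ => []) 1 (eb (f a))) (max c.maxReg 1) =
      (haltList (machine u c) (eb (f a))).stk := by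
    rw [← Store.restrict_update _ (le_max_right _ _)]
    funext i
    by_cases hi : i = (machine u c).k₁
    · subst hi
      simp only [haltList, dif_pos]
      exact update_self _ _ _
    · have : (haltList (machine u c) (eb (f a))).stk i = [] := dif_neg hi
      exact (update_of_ne hi _ _).trans this.symm
  have key : (flip bind (machine u c).step)^[n a + 1] (some (initList (machine u c) (ea a))) =
      some (haltList (machine u c) (eb (f a))) := by
    rw [h0, h1] at hsim
    rw [Nat.add_comm, iterate_add_apply]
    exact congrArg (flip bind (machine u c).step)^[1] hsim
  exact outputsInTime_congr (List.map_id (ea a)).symm (congrArg some (List.map_id (eb (f a))).symm)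
    ⟨⟨n a + 1, key⟩, by simpa using hn a⟩

end StackProgram

/-! ### Words emitted by bounded loops -/

namespace StackProgram

open Function

variable {Γ : Type}

/-- The program `c` turns the store `s` into `s'` in at most `B` steps. -/
def Runs (c : Cmd Γ) (s s' : Store Γ) (B : ℕ) : Prop := ∃ n ≤ B, Exec c s s' n

namespace Runs

variable {c d : Cmd Γ} {s s' s'' : Store Γ} {B B' : ℕ}

theorem mono (h : Runs c s s' B) (hB : B ≤ B') : Runs c s s' B' :=
  let ⟨n, hn, he⟩ := h
  ⟨n, hn.trans hB, he⟩

/-- Comparing final stores pointwise reduces nested updates to case distinctions on the stack index.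
-/
theorem of_eq (h : Runs c s s' B) (hB : B ≤ B') (hs : ∀ j, s' j = s'' j) : Runs c s s'' B' :=
  (funext hs : s' = s'') ▸ h.mono hB

theorem seq (h₁ : Runs c s s' B) (h₂ : Runs d s' s'' B') : Runs (.seq c d) s s'' (B + B') :=
  let ⟨_, hm, h₁⟩ := h₁
  let ⟨_, hn, h₂⟩ := h₂
  ⟨_, add_le_add hm hn, .seq h₁ h₂⟩

theorem skip (s : Store Γ) : Runs .skip s s 1 := ⟨1, le_rfl, .skip s⟩

theorem push (s : Store Γ) (k : ℕ) (a : Γ) : Runs (.push k a) s (update s k (a :: s k)) 1 :=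
  ⟨1, le_rfl, .push s k a⟩

theorem pop (s : Store Γ) (k : ℕ) : Runs (.pop k) s (update s k (s k).tail) 1 :=
  ⟨1, le_rfl, .pop s k⟩

theorem move_nil {k : ℕ} (l : ℕ) (h : s k = []) : Runs (.move k l) s s 1 := by
  refine ⟨1, le_rfl, ?_⟩
  have := Exec.move s k l
  rwa [show s.move k l = s by simp [Store.move, h]] at this

theorem move_cons {k l : ℕ} (hkl : k ≠ l) {a : Γ} {t : List Γ} (h : s k = a :: t) :
    Runs (.move k l) s (update (update s k t) l (a :: s l)) 1 := by
  refine ⟨1, le_rfl, ?_⟩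
  have := Exec.move s k l
  rwa [show s.move k l = update (update s k t) l (a :: s l) by
    simp [Store.move, h, update_of_ne hkl.symm]] at this

theorem ite {k l : ℕ} {p : Option Γ → Option Γ → Bool}
    (h₁ : p (s k).head? (s l).head? = true → Runs c s s' B)
    (h₂ : p (s k).head? (s l).head? = false → Runs d s s' B) :
    Runs (.ite k l p c d) s s' (1 + B) := by
  cases hp : p (s k).head? (s l).head? with
  | true =>
    obtain ⟨n, hn, h⟩ := h₁ hp
    exact ⟨1 + n, by omega, .iteTrue hp h⟩
  | false =>
    obtain ⟨n, hn, h⟩ := h₂ hp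
    exact ⟨1 + n, by omega, .iteFalse hp h⟩

theorem loop_nil {k : ℕ} (h : s k = []) : Runs (.loop k c) s s 1 := ⟨1, le_rfl, .loopDone h⟩

theorem loop_step {k : ℕ} (h : s k ≠ []) (h₁ : Runs c s s' B) (h₂ : Runs (.loop k c) s' s'' B') :
    Runs (.loop k c) s s'' (1 + B + B') :=
  let ⟨_, hm, h₁⟩ := h₁
  let ⟨_, hn, h₂⟩ := h₂
  ⟨_, by omega, .loopStep h h₁ h₂⟩

/-- A loop that passes through the stores `S 0, …, S N`. -/
theorem loop {k : ℕ} (S : ℕ → Store Γ) (N : ℕ)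
    (h : ∀ i < N, S i k ≠ [] ∧ Runs c (S i) (S (i + 1)) B) (hN : S N k = []) :
    Runs (.loop k c) (S 0) (S N) (N * (B + 1) + 1) := by
  induction N generalizing S with
  | zero => exact (loop_nil hN).mono (by omega)
  | succ N ih =>
    have := ih (fun i => S (i + 1)) (fun i hi => h (i + 1) (by omega)) hN
    exact (loop_step (h 0 (by omega)).1 (h 0 (by omega)).2 this).mono (le_of_eq (by ring))

theorem clear (s : Store Γ) (k : ℕ) :
    Runs (.loop k (.pop k)) s (update s k []) (2 * (s k).length + 1) := by
  induction h : s k generalizing s with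
  | nil =>
    exact (loop_nil h).of_eq (by simp) fun j => by rw [← h, update_eq_self]
  | cons a t ih =>
    have := ih (update s k t) (by simp)
    rw [update_idem] at this
    have hp := pop s k
    rw [h, List.tail_cons] at hp
    exact (loop_step (by simp [h]) hp this).mono (by simp; omega)

/-- Moving symbol by symbol reverses a word, so draining away and back restores it, and a word
pushed in reverse is put right by one drain. -/
theorem drain (s : Store Γ) {k l : ℕ} (hkl : k ≠ l) :
    Runs (.loop k (.move k l)) s (update (update s k []) l ((s k).reverse ++ s l))
      (2 * (s k).length + 1) := by
  induction h : s k generalizing s with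
  | nil =>
    exact (loop_nil h).of_eq (by simp) fun j => by
      rw [← h, update_eq_self, h, List.reverse_nil, List.nil_append, update_eq_self]
  | cons a t ih =>
    have := ih (update (update s k t) l (a :: s l)) (by simp [update_of_ne hkl])
    refine (loop_step (by simp [h]) (move_cons hkl h) this).of_eq (by simp; omega) fun j => ?_
    simp only [update_apply]
    split_ifs <;> simp_all

/-- Half of a nondestructive copy in unary: the symbols wait on `l` until a `drain` puts them back.
-/
theorem tally (s : Store Γ) {k l m : ℕ} (u : Γ) (hkl : k ≠ l) (hkm : k ≠ m) (hlm : l ≠ m) :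
    Runs (.loop k (.seq (.move k l) (.push m u))) s
      (update (update (update s k []) l ((s k).reverse ++ s l)) m
        (List.replicate (s k).length u ++ s m)) (3 * (s k).length + 1) := by
  induction h : s k generalizing s with
  | nil =>
    refine (loop_nil h).of_eq (by simp) fun j => ?_
    simp only [update_apply]
    split_ifs <;> simp_all
  | cons a t ih =>
    have := ih (update (update (update s k t) l (a :: s l)) m (u :: s m))
      (by simp [update_of_ne hkl, update_of_ne hkm])
    have h₁ := (move_cons hkl h).seq (push _ m u)
    rw [update_of_ne hlm.symm, update_of_ne hkm.symm] at h₁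
    refine (loop_step (by simp [h]) h₁ this).of_eq (by simp; omega) fun j => ?_
    simp only [update_apply]
    split_ifs <;> simp_all [List.replicate_succ']

/-- Popping an empty stack does nothing, so on unary numbers this is truncated subtraction. -/
theorem popBoth (s : Store Γ) {k l : ℕ} (hkl : k ≠ l) :
    Runs (.loop k (.seq (.pop k) (.pop l))) s
      (update (update s k []) l ((s l).drop (s k).length)) (3 * (s k).length + 1) := by
  induction h : s k generalizing s with
  | nil =>
    refine (loop_nil h).of_eq (by simp) fun j => ?_
    simp only [update_apply]
    split_ifs <;> simp_all
  | cons a t ih =>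
    have := ih (update (update s k t) l (s l).tail) (by simp [update_of_ne hkl])
    have h₁ := (pop s k).seq (pop _ l)
    rw [update_of_ne hkl.symm, h, List.tail_cons] at h₁
    refine (loop_step (by simp [h]) h₁ this).of_eq (by simp; omega) fun j => ?_
    simp only [update_apply]
    split_ifs <;> simp_all [List.drop_tail]

/-- Random access: afterwards the top of `l` is its former symbol at position `(s k).length`, or `l`
is empty if there was none. The skipped prefix is kept on `m`. -/
theorem advance (s : Store Γ) {k l m : ℕ} (hkl : k ≠ l) (hkm : k ≠ m) (hlm : l ≠ m) :
    Runs (.loop k (.seq (.pop k) (.move l m))) s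
      (update (update (update s k []) l ((s l).drop (s k).length)) m
        (((s l).take (s k).length).reverse ++ s m)) (3 * (s k).length + 1) := by
  induction h : s k generalizing s with
  | nil =>
    refine (loop_nil h).of_eq (by simp) fun j => ?_
    simp only [update_apply]
    split_ifs <;> simp_all
  | cons a t ih =>
    have hp := pop s k
    rw [h, List.tail_cons] at hp
    cases hl : s l with
    | nil =>
      have := ih (update s k t) (by simp)
      have h₁ := hp.seq (move_nil (s := update s k t) m (by rw [update_of_ne hkl.symm, hl]))
      refine (loop_step (by simp [h]) h₁ this).of_eq (by simp; omega) fun j => ?_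
      simp only [update_apply]
      split_ifs <;> simp_all
    | cons b r =>
      have := ih (update (update (update s k t) l r) m (b :: s m))
        (by simp [update_of_ne hkl, update_of_ne hkm])
      have h₁ := hp.seq (move_cons (s := update s k t) hlm
        (by rw [update_of_ne hkl.symm, hl]))
      rw [update_of_ne hkm.symm] at h₁
      refine (loop_step (by simp [h]) h₁ this).of_eq (by simp; omega) fun j => ?_
      simp only [update_apply]
      split_ifs <;> simp_all

end Runs

/-- The number of positions of the first list where the second list has a different symbol or
none. -/
def mismatches [DecidableEq Γ] : List Γ → List Γ → ℕ
  | [], _ => 0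
  | a :: L, M => mismatches L M.tail + (if M.head? = some a then 0 else 1)

theorem mismatches_le [DecidableEq Γ] (L M : List Γ) : mismatches L M ≤ L.length := by
  induction L generalizing M with
  | nil => simp [mismatches]
  | cons a L ih =>
    have := ih M.tail
    simp only [mismatches, List.length_cons]
    split_ifs <;> omega

/-- A second list that is too short already causes a mismatch; one that is too long is caught by the
remainder. -/
theorem mismatches_eq_zero_iff [DecidableEq Γ] (L M : List Γ) :
    (mismatches L M = 0 ∧ M.drop L.length = []) ↔ M = L := by
  induction L generalizing M with
  | nil => simp [mismatches]
  | cons a L ih =>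
    cases M with
    | nil => simp [mismatches]
    | cons b M =>
      have := ih M
      by_cases hab : b = a
      · simpa [mismatches, hab] using this
      · simp [mismatches, hab]

/-- Stack `k` is saved on `l` while `d` is consumed; every disagreement leaves a mark on `e`, so
equality becomes emptiness of `d` and `e`. -/
theorem Runs.compare [DecidableEq Γ] (s : Store Γ) {k l d e : ℕ} (u : Γ) (hkl : k ≠ l)
    (hkd : k ≠ d) (hke : k ≠ e) (hld : l ≠ d) (hle : l ≠ e) (hde : d ≠ e) :
    Runs (.loop k (.seq (.ite k d (fun a b => decide (b = a)) .skip (.push e u))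
        (.seq (.move k l) (.pop d)))) s
      (update (update (update (update s k []) l ((s k).reverse ++ s l)) d
        ((s d).drop (s k).length)) e
        (List.replicate (mismatches (s k) (s d)) u ++ s e)) (5 * (s k).length + 1) := by
  induction h : s k generalizing s with
  | nil =>
    refine (loop_nil h).of_eq (by simp) fun j => ?_
    simp only [update_apply]
    split_ifs <;> simp_all [mismatches]
  | cons a t ih =>
    have hite : Runs (.ite k d (fun a b => decide (b = a)) .skip (.push e u)) s
        (update s e (List.replicate (if (s d).head? = some a then 0 else 1) u ++ s e)) (1 + 1) := by
      refine ite (fun hp => ?_) (fun hp => ?_)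
      · have hp : (s d).head? = some a := by simpa [h] using hp
        simpa [hp] using skip s
      · have hp : ¬ (s d).head? = some a := by simpa [h] using hp
        simpa [hp] using push s e u
    generalize hq : (if (s d).head? = some a then 0 else 1) = q at hite
    have h₁ := hite.seq ((move_cons (k := k) (l := l) hkl (a := a) (t := t)
      (by rw [update_of_ne hke, h])).seq (pop _ d))
    refine ((loop_step (by simp [h]) h₁ (ih _ ?_))).of_eq ?_ fun j => ?_
    · simp [update_of_ne hkl, update_of_ne hkd]
    · simp; omega
    · simp only [update_apply]
      split_ifs <;> (simp_all [mismatches, List.drop_tail]; try simp [← List.append_assoc])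

theorem _root_.Polynomial.eval_le_eval_of_le (P : Polynomial ℕ) {a b : ℕ} (h : a ≤ b) :
    P.eval a ≤ P.eval b := by
  rw [Polynomial.eval_eq_sum, Polynomial.eval_eq_sum]
  exact Finset.sum_le_sum fun i _ => Nat.mul_le_mul_left _ (Nat.pow_le_pow_left h i)

end StackProgram

/-! ### A calculus of emitted words and its translation into stack programs. -/

namespace StackProgram

open Function

variable {Γ : Type}

/-- Words that depend on an input word `w` and on `n` numbers `v` and that can be written by a
program of bounded loops: there are constructions for symbols, concatenation, bounded loops,
variables and truncated subtraction in unary notation (with the symbol `u` as the unit), access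
to the input at a computed position, the length of the input, and comparison with the input. -/
inductive Emit [DecidableEq Γ] (u : Γ) : {n : ℕ} → (List Γ → (Fin n → ℕ) → List Γ) → Prop
  | sym {n : ℕ} (a : Γ) : Emit u (fun _ (_ : Fin n → ℕ) => [a])
  | append {n : ℕ} {F G : List Γ → (Fin n → ℕ) → List Γ} : Emit u F → Emit u G →
      Emit u (fun w v => F w v ++ G w v)
  | forRange {n : ℕ} {b : List Γ → (Fin n → ℕ) → ℕ} {F : List Γ → (Fin (n + 1) → ℕ) → List Γ} :
      Emit u (fun w v => List.replicate (b w v) u) → Emit u F →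
      Emit u (fun w v => (List.range (b w v)).flatMap fun i => F w (Fin.cons i v))
  | var {n : ℕ} (i : Fin n) : Emit u (fun _ v => List.replicate (v i) u)
  | sub {n : ℕ} {a b : List Γ → (Fin n → ℕ) → ℕ} :
      Emit u (fun w v => List.replicate (a w v) u) → Emit u (fun w v => List.replicate (b w v) u) →
      Emit u (fun w v => List.replicate (a w v - b w v) u)
  | inputAt {n : ℕ} {t : List Γ → (Fin n → ℕ) → ℕ} (a : Γ) :
      Emit u (fun w v => List.replicate (t w v) u) →
      Emit u (fun w v => if w[t w v]? = some a then [u] else [])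
  | length {n : ℕ} : Emit u (fun w (_ : Fin n → ℕ) => List.replicate w.length u)
  | eqInput {n : ℕ} {F : List Γ → (Fin n → ℕ) → List Γ} : Emit u F →
      Emit u (fun w v => if F w v = w then [u] else [])

/-- When the input is on the stack `0`, the variables are in unary notation on the stacks `ρ i`
and the stacks `1` and `d, d + 1, …` are empty, the program `c` pushes the reverse of `F` to the
stack `tgt` and changes nothing else, in at most `T (|w| + ∑ v i)` steps. -/
def Cmd.Emits (c : Cmd Γ) (u : Γ) {n : ℕ} (ρ : Fin n → ℕ) (tgt d : ℕ)
    (F : List Γ → (Fin n → ℕ) → List Γ) (T : ℕ → ℕ) : Prop :=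
  ∀ (w : List Γ) (v : Fin n → ℕ) (s : Store Γ), s 0 = w → s 1 = [] →
    (∀ i, s (ρ i) = List.replicate (v i) u) → (∀ j, d ≤ j → s j = []) →
    Runs c s (update s tgt ((F w v).reverse ++ s tgt)) (T (w.length + ∑ i, v i))

/-- `F` has polynomial length and is written in polynomial time, for every choice of stacks. -/
def PolyEmits (u : Γ) {n : ℕ} (F : List Γ → (Fin n → ℕ) → List Γ) : Prop :=
  ∃ P : Polynomial ℕ, (∀ w v, (F w v).length ≤ P.eval (w.length + ∑ i, v i)) ∧
    ∀ (ρ : Fin n → ℕ) (tgt d : ℕ), 2 ≤ tgt → tgt < d → (∀ i, 2 ≤ ρ i ∧ ρ i < d ∧ ρ i ≠ tgt) →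
      ∃ c : Cmd Γ, c.Emits u ρ tgt d F P.eval

namespace PolyEmits

variable {u : Γ} {n : ℕ}

theorem sym (a : Γ) : PolyEmits u (fun _ (_ : Fin n → ℕ) => [a]) :=
  ⟨1, fun _ _ => by simp, fun _ tgt _ _ _ _ =>
    ⟨.push tgt a, fun _ _ s _ _ _ _ => (Runs.push s tgt a).mono (by simp)⟩⟩

theorem append {F G : List Γ → (Fin n → ℕ) → List Γ} (hF : PolyEmits u F) (hG : PolyEmits u G) :
    PolyEmits u (fun w v => F w v ++ G w v) := by
  obtain ⟨P, hP, hF⟩ := hF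
  obtain ⟨Q, hQ, hG⟩ := hG
  refine ⟨P + Q, fun w v => ?_, fun ρ tgt d ht hd hρ => ?_⟩
  · simpa using add_le_add (hP w v) (hQ w v)
  obtain ⟨c, hc⟩ := hF ρ tgt d ht hd hρ
  obtain ⟨c', hc'⟩ := hG ρ tgt d ht hd hρ
  refine ⟨.seq c c', fun w v s h0 h1 hv he => ?_⟩
  refine ((hc w v s h0 h1 hv he).seq (hc' w v _ ?_ ?_ (fun i => ?_) fun j hj => ?_)).of_eq
    (by simp) fun j => ?_
  · rw [update_of_ne (by omega), h0]
  · rw [update_of_ne (by omega), h1]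
  · rw [update_of_ne (hρ i).2.2, hv]
  · rw [update_of_ne (by omega), he j hj]
  · simp only [update_apply]
    split_ifs <;> simp

theorem var (i : Fin n) : PolyEmits u (fun _ v => List.replicate (v i) u) := by
  have hle (v : Fin n → ℕ) : v i ≤ ∑ j, v j :=
    Finset.single_le_sum (fun _ _ => Nat.zero_le _) (Finset.mem_univ i)
  refine ⟨5 * .X + 2, fun w v => ?_, fun ρ tgt d ht hd hρ => ?_⟩
  · have := hle v
    simp; omega
  have := hρ i
  refine ⟨.seq (.loop (ρ i) (.seq (.move (ρ i) d) (.push tgt u))) (.loop d (.move d (ρ i))),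
    fun w v s h0 h1 hv he => ?_⟩
  refine ((Runs.tally s (l := d) u this.2.1.ne this.2.2 hd.ne').seq
    (Runs.drain _ this.2.1.ne')).of_eq ?_ fun j => ?_
  · have := hle v
    simp [hd.ne', hv, he]
    omega
  · simp only [update_apply]
    split_ifs <;> simp_all

theorem length : PolyEmits u (fun w (_ : Fin n → ℕ) => List.replicate w.length u) := by
  refine ⟨5 * .X + 2, fun w v => ?_, fun ρ tgt d ht hd hρ => ?_⟩
  · simp; omega
  refine ⟨.seq (.loop 0 (.seq (.move 0 1) (.push tgt u))) (.loop 1 (.move 1 0)),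
    fun w v s h0 h1 hv he => ?_⟩
  refine ((Runs.tally s u (k := 0) (l := 1) (m := tgt) (by omega) (by omega) (by omega)).seq
    (Runs.drain _ (by omega))).of_eq ?_ fun j => ?_
  · simp [show 1 ≠ tgt by omega, h0, h1]
    omega
  · simp only [update_apply]
    have : tgt ≠ 0 ∧ tgt ≠ 1 := by omega
    split_ifs <;> simp_all

theorem sub {a b : List Γ → (Fin n → ℕ) → ℕ} (ha : PolyEmits u fun w v => List.replicate (a w v) u)
    (hb : PolyEmits u fun w v => List.replicate (b w v) u) :
    PolyEmits u (fun w v => List.replicate (a w v - b w v) u) := by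
  obtain ⟨P, hP, ha⟩ := ha
  obtain ⟨Q, hQ, hb⟩ := hb
  simp only [List.length_replicate] at hP hQ
  refine ⟨3 * P + 4 * Q + 2, fun w v => ?_, fun ρ tgt d ht hd hρ => ?_⟩
  · have := hP w v
    simp; omega
  have hρ' : ∀ e, d ≤ e → e < d + 2 → ∀ i, 2 ≤ ρ i ∧ ρ i < d + 2 ∧ ρ i ≠ e := fun e h₁ h₂ i => by
    have := hρ i; omega
  obtain ⟨c, hc⟩ := ha ρ d (d + 2) (by omega) (by omega) (hρ' d (by omega) (by omega))
  obtain ⟨c', hc'⟩ := hb ρ (d + 1) (d + 2) (by omega) (by omega)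
    (hρ' (d + 1) (by omega) (by omega))
  refine ⟨.seq c (.seq c' (.seq (.loop (d + 1) (.seq (.pop (d + 1)) (.pop d)))
    (.loop d (.move d tgt)))), fun w v s h0 h1 hv he => ?_⟩
  have hed := he d le_rfl
  have hed' := he (d + 1) (by omega)
  refine ((hc w v s h0 h1 hv (fun j hj => he j (by omega))).seq
    ((hc' w v _ ?_ ?_ (fun i => ?_) fun j hj => ?_).seq
      ((Runs.popBoth _ (by omega)).seq (Runs.drain _ hd.ne')))).of_eq ?_ fun j => ?_
  · rw [update_of_ne (by omega), h0]
  · rw [update_of_ne (by omega), h1]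
  · rw [update_of_ne (by have := hρ i; omega), hv]
  · rw [update_of_ne (by omega), he j (by omega)]
  · have h₁ := hP w v
    have h₂ := hQ w v
    simp [hed, hed']
    omega
  · have hne : d ≠ tgt ∧ d + 1 ≠ tgt := by omega
    clear hc hc' hv he hP hQ hρ hρ'
    simp [update_apply, hed, hed']
    split_ifs <;> simp_all

theorem inputAt [DecidableEq Γ] {t : List Γ → (Fin n → ℕ) → ℕ} (a : Γ)
    (ht : PolyEmits u fun w v => List.replicate (t w v) u) :
    PolyEmits u (fun w v => if w[t w v]? = some a then [u] else []) := by
  obtain ⟨P, hP, ht⟩ := ht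
  simp only [List.length_replicate] at hP
  refine ⟨4 * P + 2 * .X + 4, fun w v => ?_, fun ρ tgt d htgt hd hρ => ?_⟩
  · dsimp only
    split_ifs <;> simp
  obtain ⟨c, hc⟩ := ht ρ d (d + 1) (by omega) (by omega) (fun i => by have := hρ i; omega)
  -- Stack `1` holds the part of the input in front of the position read, and is drained back at the
  -- end.
  refine ⟨.seq c (.seq (.loop d (.seq (.pop d) (.move 0 1)))
    (.seq (.ite 0 0 (fun o _ => decide (o = some a)) (.push tgt u) .skip) (.loop 1 (.move 1 0)))),
    fun w v s h0 h1 hv he => ?_⟩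
  have hed := he d le_rfl
  have hite : ∀ s' : Store Γ, Runs (.ite 0 0 (fun o _ => decide (o = some a)) (.push tgt u) .skip)
      s' (update s' tgt ((if (s' 0).head? = some a then [u] else []) ++ s' tgt)) (1 + 1) := by
    intro s'
    refine Runs.ite (fun h => ?_) (fun h => ?_)
    · simpa [of_decide_eq_true h] using Runs.push s' tgt u
    · simpa [of_decide_eq_false h] using Runs.skip s'
  refine ((hc w v s h0 h1 hv (fun j hj => he j (by omega))).seq
    ((Runs.advance _ (by omega) (by omega) (by omega)).seq
      ((hite _).seq (Runs.drain _ (by omega))))).of_eq ?_ fun j => ?_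
  · have h₁ := hP w v
    have : tgt ≠ 0 ∧ tgt ≠ 1 ∧ d ≠ 0 ∧ d ≠ 1 := by omega
    simp [hed, h0, h1, update_apply, this, this.2.1.symm, this.2.2.1.symm, this.2.2.2.symm]
    omega
  · have : tgt ≠ 0 ∧ tgt ≠ 1 ∧ d ≠ 0 ∧ d ≠ 1 := by omega
    have hdt := hd.ne
    clear hc hv he hP hρ hite
    simp [update_apply, hed, h0, h1, this, hdt, this.1.symm, this.2.1.symm, this.2.2.1.symm,
      this.2.2.2.symm]
    split_ifs <;> simp_all

theorem eqInput [DecidableEq Γ] {F : List Γ → (Fin n → ℕ) → List Γ} (hF : PolyEmits u F) :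
    PolyEmits u (fun w v => if F w v = w then [u] else []) := by
  obtain ⟨P, hP, hF⟩ := hF
  refine ⟨3 * P + 9 * .X + 6, fun w v => ?_, fun ρ tgt d ht hd hρ => ?_⟩
  · dsimp only
    split_ifs <;> simp
  obtain ⟨c, hc⟩ := hF ρ d (d + 2) (by omega) (by omega) (fun i => by have := hρ i; omega)
  -- Both words are compared in reverse: `c` leaves the emitted word reversed on `d`, and the first
  -- drain leaves the input reversed on `1`. The comparison itself restores the input.
  refine ⟨.seq c (.seq (.loop 0 (.move 0 1)) (.seq (.loop 1 (.seq
      (.ite 1 d (fun a b => decide (b = a)) .skip (.push (d + 1) u)) (.seq (.move 1 0) (.pop d))))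
    (.seq (.ite d (d + 1) (fun a b => decide (a = none ∧ b = none)) (.push tgt u) .skip)
    (.seq (.loop d (.pop d)) (.loop (d + 1) (.pop (d + 1))))))), fun w v s h0 h1 hv he => ?_⟩
  have hed := he d le_rfl
  have hed' := he (d + 1) (by omega)
  have hite : ∀ s' : Store Γ,
      Runs (.ite d (d + 1) (fun a b => decide (a = none ∧ b = none)) (.push tgt u) .skip)
      s' (update s' tgt ((if s' d = [] ∧ s' (d + 1) = [] then [u] else []) ++ s' tgt)) (1 + 1) := by
    intro s'
    refine Runs.ite (fun h => ?_) (fun h => ?_)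
    · have h : s' d = [] ∧ s' (d + 1) = [] := by simpa using h
      simpa [h] using Runs.push s' tgt u
    · have h : ¬ (s' d = [] ∧ s' (d + 1) = []) := by simpa using h
      simpa [h] using Runs.skip s'
  refine ((hc w v s h0 h1 hv (fun j hj => he j (by omega))).seq
    ((Runs.drain _ (by omega)).seq ((Runs.compare _ (k := 1) (l := 0) (d := d) (e := d + 1) u
      (by omega) (by omega) (by omega) (by omega) (by omega) (by omega)).seq
      ((hite _).seq ((Runs.clear _ d).seq (Runs.clear _ (d + 1))))))).of_eq ?_ fun j => ?_
  · have h₁ := hP w v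
    have h₂ := mismatches_le w.reverse (F w v).reverse
    have : tgt ≠ 0 ∧ tgt ≠ 1 ∧ d ≠ 0 ∧ d ≠ 1 ∧ tgt ≠ d ∧ tgt ≠ d + 1 := by omega
    simp [hed, hed', h0, h1, this, this.2.2.1.symm,
      this.2.2.2.1.symm, this.2.2.2.2.1.symm, this.2.2.2.2.2.symm] at h₂ ⊢
    omega
  · have hne : tgt ≠ 0 ∧ tgt ≠ 1 ∧ d ≠ 0 ∧ d ≠ 1 ∧ tgt ≠ d ∧ tgt ≠ d + 1 := by omega
    have key := mismatches_eq_zero_iff w.reverse (F w v).reverse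
    rw [List.reverse_inj, List.length_reverse] at key
    clear hc hv he hP hρ hite
    simp [update_apply, hed, hed', h0, h1, hne, hne.2.2.1.symm,
      hne.2.2.2.1.symm]
    split_ifs <;> simp_all

theorem forRange {b : List Γ → (Fin n → ℕ) → ℕ} {F : List Γ → (Fin (n + 1) → ℕ) → List Γ}
    (hb : PolyEmits u fun w v => List.replicate (b w v) u) (hF : PolyEmits u F) :
    PolyEmits u (fun w v => (List.range (b w v)).flatMap fun i => F w (Fin.cons i v)) := by
  obtain ⟨P, hP, hb⟩ := hb
  obtain ⟨Q, hQ, hF⟩ := hF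
  simp only [List.length_replicate] at hP
  -- The index stays below the bound, which is at most `P` of the size; so the body always runs on
  -- size at most `X + P`, and composing the polynomials bounds its time.
  have hQ' : ∀ w v, ∀ i < b w v, Q.eval (w.length + ∑ j, (Fin.cons i v : Fin (n + 1) → ℕ) j) ≤
      Q.eval ((w.length + ∑ j, v j) + P.eval (w.length + ∑ j, v j)) := fun w v i hi => by
    refine Q.eval_le_eval_of_le ?_
    have := hP w v
    simp only [Fin.sum_univ_succ, Fin.cons_zero, Fin.cons_succ]
    omega
  -- Each of at most `P` passes costs the body plus a test, a pop and a push. Writing the bound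
  -- costs `P`, clearing the counter `2 * P + 1`, and leaving the loop `1`.
  refine ⟨P * (Q.comp (.X + P) + 3) + 3 * P + 2, fun w v => ?_, fun ρ tgt d ht hd hρ => ?_⟩
  · have h₁ : ((List.range (b w v)).flatMap fun i => F w (Fin.cons i v)).length ≤
        b w v * Q.eval ((w.length + ∑ j, v j) + P.eval (w.length + ∑ j, v j)) := by
      rw [List.length_flatMap]
      refine (List.sum_le_card_nsmul _ (Q.eval ((w.length + ∑ j, v j) +
        P.eval (w.length + ∑ j, v j))) fun x hx => ?_).trans (le_of_eq (by simp))
      obtain ⟨i, hi, rfl⟩ := List.mem_map.1 hx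
      exact (hQ _ _).trans (hQ' w v i (List.mem_range.1 hi))
    have h₂ := Nat.mul_le_mul_right
      (Q.eval ((w.length + ∑ j, v j) + P.eval (w.length + ∑ j, v j))) (hP w v)
    refine h₁.trans (h₂.trans ?_)
    simp [mul_add]
    omega
  obtain ⟨c, hc⟩ := hb ρ d (d + 2) (by omega) (by omega) (fun i => by have := hρ i; omega)
  obtain ⟨c', hc'⟩ := hF (Fin.cons (d + 1) ρ) tgt (d + 2) (by omega) (by omega) (fun i => by
    refine Fin.cases ?_ (fun i => ?_) i
    · simp; omega
    · have := hρ i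
      simp; omega)
  refine ⟨.seq c (.seq (.loop d (.seq (.pop d) (.seq c' (.push (d + 1) u))))
    (.loop (d + 1) (.pop (d + 1)))), fun w v s h0 h1 hv he => ?_⟩
  have hed := he d le_rfl
  have hed' := he (d + 1) (by omega)
  -- The loop invariant: stack `d` counts down and ends the loop, stack `d + 1` counts up and is the
  -- loop variable of the body.
  obtain ⟨S, hS⟩ : ∃ S : ℕ → Store Γ, ∀ i j, S i j =
      if j = tgt then ((List.range i).flatMap fun i => F w (Fin.cons i v)).reverse ++ s tgt
      else if j = d + 1 then List.replicate i u
      else if j = d then List.replicate (b w v - i) u else s j := ⟨_, fun _ _ => rfl⟩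
  have hne : tgt ≠ d ∧ tgt ≠ d + 1 := by omega
  have hloop : Runs (.loop d (.seq (.pop d) (.seq c' (.push (d + 1) u)))) (S 0) (S (b w v))
      (b w v * (1 + (Q.eval ((w.length + ∑ j, v j) + P.eval (w.length + ∑ j, v j)) + 1) + 1) + 1) := by
    refine Runs.loop (B := 1 + (Q.eval ((w.length + ∑ j, v j) + P.eval (w.length + ∑ j, v j)) + 1))
      S (b w v) (fun i hi => ⟨?_, ?_⟩) ?_
    · simp [hS, hne.1.symm, Nat.sub_eq_zero_iff_le, hi]
    · have h₁ := hc' w (Fin.cons i v) (update (S i) d (S i d).tail) ?_ ?_ ?_ ?_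
      · refine ((Runs.pop (S i) d).seq ((h₁.mono (hQ' w v i hi)).seq
          (Runs.push _ (d + 1) u))).of_eq le_rfl fun j => ?_
        by_cases h₂ : j = tgt
        · simp [h₂, hS, hne, List.range_succ]
        by_cases h₃ : j = d + 1
        · simp [h₃, hS, hne.2.symm, List.replicate_succ]
        rw [update_of_ne h₃, update_of_ne h₂, update_apply]
        by_cases h₄ : j = d
        · simp [h₄, hS, hne.1.symm, Nat.sub_sub]
        · simp [h₂, h₃, h₄, hS]
      · simp [hS, show 0 ≠ d by omega, show 0 ≠ tgt by omega, h0]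
      · simp [hS, show 1 ≠ d by omega, show 1 ≠ tgt by omega,
          show d ≠ 0 by omega, h1]
      · intro j
        refine Fin.cases ?_ (fun j => ?_) j
        · simp [hS, hne.2.symm]
        · have := hρ j
          simp [hS, this.2.1.ne, this.2.2, show ρ j ≠ d + 1 by omega, hv]
      · intro j hj
        simp [hS, show j ≠ d by omega, show j ≠ d + 1 by omega,
          show j ≠ tgt by omega, he j (by omega)]
    · simp [hS, hne.1.symm]
  have hstart : S 0 = update s d ((List.replicate (b w v) u).reverse ++ s d) := by
    funext j
    rw [hS, update_apply, List.reverse_replicate, hed, List.append_nil]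
    by_cases h₂ : j = tgt
    · simp [h₂, hne]
    by_cases h₃ : j = d + 1
    · simp [h₃, hne.2.symm, hed']
    · simp [h₂, h₃]
  rw [hstart] at hloop
  refine ((hc w v s h0 h1 hv (fun j hj => he j (by omega))).seq
    (hloop.seq (Runs.clear _ (d + 1)))).of_eq ?_ fun j => ?_
  · have h₂ := hP w v
    have h₃ := Nat.mul_le_mul_right
      (Q.eval ((w.length + ∑ j, v j) + P.eval (w.length + ∑ j, v j)) + 3) h₂
    simp [hS, hne.2.symm, mul_add] at h₃ ⊢
    omega
  · by_cases h₁ : j = d + 1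
    · simp [h₁, hed', update_of_ne hne.2.symm]
    rw [update_of_ne h₁, hS, update_apply, if_neg h₁]
    by_cases h₂ : j = d
    · simp [h₂, hed, hne.1.symm]
    · rw [if_neg h₂]

end PolyEmits

theorem Emit.polyEmits [DecidableEq Γ] {u : Γ} {n : ℕ} {F : List Γ → (Fin n → ℕ) → List Γ}
    (h : Emit u F) : PolyEmits u F := by
  induction h with
  | sym a => exact .sym a
  | append _ _ ihF ihG => exact .append ihF ihG
  | forRange _ _ ihb ihF => exact .forRange ihb ihF
  | var i => exact .var i
  | sub _ _ iha ihb => exact .sub iha ihb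
  | inputAt a _ ih => exact .inputAt a ih
  | length => exact .length
  | eqInput _ ih => exact .eqInput ih

/-- A function between encoded types is computable in polynomial time when the code of its value
is emitted from the code of its argument. -/
theorem Emit.polyTime [DecidableEq Γ] [Fintype Γ] {u : Γ} {F : List Γ → (Fin 0 → ℕ) → List Γ}
    (h : Emit u F) {α β : Type} (ea : α → List Γ) (eb : β → List Γ) (f : α → β)
    (hf : ∀ a, F (ea a) ![] = eb (f a)) :
    Nonempty (Turing.TM2ComputableInPolyTime ea eb f) := by
  obtain ⟨P, hP, hF⟩ := h.polyEmits
  obtain ⟨c, hc⟩ := hF ![] 2 3 (by omega) (by omega) (fun i => i.elim0)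
  -- Stacks `0` and `1` are reserved for the input and as scratch space, so the word is emitted on
  -- `2`; the final drain to `1` undoes the reversal.
  refine polyTime_of_exec u ea eb f
    (.seq c (.seq (.loop 0 (.pop 0)) (.loop 2 (.move 2 1)))) (3 * P + 2 * .X + 2) fun a => ?_
  have h₁ := hc (ea a) ![] (update (fun _ => []) 0 (ea a)) (by simp) (by simp)
    (fun i => i.elim0) (fun j hj => by simp [update_apply]; omega)
  refine (h₁.seq ((Runs.clear _ 0).seq (Runs.drain _ (by omega)))).of_eq ?_ fun j => ?_
  · have := hP (ea a) ![]
    simp at this ⊢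
    omega
  · rw [← hf]
    simp only [update_apply]
    split_ifs <;> simp_all

end StackProgram

/-! ### Closure properties of emitted words, numbers and conditions -/

namespace StackProgram

open Function

variable {Γ : Type} [DecidableEq Γ] {u : Γ} {n : ℕ}

theorem Emit.of_eq {F G : List Γ → (Fin n → ℕ) → List Γ} (h : Emit u F)
    (hFG : ∀ w v, F w v = G w v) : Emit u G :=
  (funext₂ hFG : F = G) ▸ h

/-- Variables act as de Bruijn indices. Allowing every renaming, not only a shift, lets the
induction pass under a loop, where the renaming is extended to fix the bound variable. -/
theorem Emit.rename {F : List Γ → (Fin n → ℕ) → List Γ} (h : Emit u F) {m : ℕ}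
    (σ : Fin n → Fin m) : Emit u (fun w v => F w (v ∘ σ)) := by
  induction h generalizing m with
  | sym a => exact .sym a
  | append _ _ ihF ihG => exact .append (ihF σ) (ihG σ)
  | forRange _ _ ihb ihF =>
    refine (Emit.forRange (ihb σ) (ihF (Fin.cons 0 (Fin.succ ∘ σ)))).of_eq fun w v => ?_
    congr 1
    funext i
    congr 1
    funext j
    refine Fin.cases ?_ (fun j => ?_) j <;> simp
  | var i => exact .var (σ i)
  | sub _ _ iha ihb => exact .sub (iha σ) (ihb σ)
  | inputAt a _ ih => exact .inputAt a (ih σ)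
  | length => exact .length
  | eqInput _ ih => exact .eqInput (ih σ)

theorem Emit.weaken {F : List Γ → (Fin n → ℕ) → List Γ} (h : Emit u F) :
    Emit u (fun w (v : Fin (n + 1) → ℕ) => F w (Fin.tail v)) :=
  h.rename Fin.succ

/-- Numbers that can be written in unary notation by a program of bounded loops. -/
def EmitNat (u : Γ) {n : ℕ} (f : List Γ → (Fin n → ℕ) → ℕ) : Prop :=
  Emit u fun w v => List.replicate (f w v) u

/-- Conditions that can be decided by a program of bounded loops. -/
def EmitProp (u : Γ) {n : ℕ} (p : List Γ → (Fin n → ℕ) → Prop) : Prop :=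
  ∃ f, EmitNat u f ∧ ∀ w v, 0 < f w v ↔ p w v

namespace Emit

theorem loop {b : List Γ → (Fin n → ℕ) → ℕ} {F : List Γ → ℕ → (Fin n → ℕ) → List Γ}
    (hb : EmitNat u b) (hF : Emit u fun w (v : Fin (n + 1) → ℕ) => F w (v 0) (Fin.tail v)) :
    Emit u (fun w v => (List.range (b w v)).flatMap fun i => F w i v) :=
  (Emit.forRange hb hF).of_eq fun w v => by simp

end Emit

namespace EmitNat

variable {a b : List Γ → (Fin n → ℕ) → ℕ}

theorem of_eq (h : EmitNat u a) (hab : ∀ w v, a w v = b w v) : EmitNat u b :=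
  (funext₂ hab : a = b) ▸ h

theorem weaken (h : EmitNat u a) :
    EmitNat u (fun w (v : Fin (n + 1) → ℕ) => a w (Fin.tail v)) :=
  Emit.weaken h

theorem var (i : Fin n) : EmitNat u (fun _ v => v i) := Emit.var i

theorem length : EmitNat u (fun w (_ : Fin n → ℕ) => w.length) := Emit.length

theorem add (ha : EmitNat u a) (hb : EmitNat u b) : EmitNat u (fun w v => a w v + b w v) :=
  (Emit.append ha hb).of_eq fun w v => by simp

theorem sub (ha : EmitNat u a) (hb : EmitNat u b) : EmitNat u (fun w v => a w v - b w v) :=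
  Emit.sub ha hb

theorem one : EmitNat u (fun _ (_ : Fin n → ℕ) => 1) := Emit.sym u

theorem const (c : ℕ) : EmitNat u (fun _ (_ : Fin n → ℕ) => c) := by
  induction c with
  | zero => exact one.sub one
  | succ c ih => exact ih.add one

/-- Concatenation adds unary numbers, so a loop computes a sum. Products, counts, division and
bounded quantifiers all come from this. -/
theorem sum {f : List Γ → ℕ → (Fin n → ℕ) → ℕ} (hb : EmitNat u b)
    (hf : EmitNat u fun w (v : Fin (n + 1) → ℕ) => f w (v 0) (Fin.tail v)) :
    EmitNat u (fun w v => ∑ i ∈ Finset.range (b w v), f w i v) := by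
  refine (Emit.loop (F := fun w i v => List.replicate (f w i v) u) hb hf).of_eq fun w v => ?_
  dsimp only
  induction b w v with
  | zero => simp
  | succ k ih => simp [List.range_succ, Finset.sum_range_succ, ih]

theorem mul (ha : EmitNat u a) (hb : EmitNat u b) : EmitNat u (fun w v => a w v * b w v) :=
  (sum (f := fun w _ v => b w v) ha hb.weaken).of_eq fun w v => by simp

end EmitNat

namespace EmitProp

variable {p q : List Γ → (Fin n → ℕ) → Prop} {a b : List Γ → (Fin n → ℕ) → ℕ}

theorem of_iff (h : EmitProp u p) (hpq : ∀ w v, p w v ↔ q w v) : EmitProp u q :=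
  let ⟨_, hf, hp⟩ := h
  ⟨_, hf, fun w v => (hp w v).trans (hpq w v)⟩

theorem lt (ha : EmitNat u a) (hb : EmitNat u b) : EmitProp u (fun w v => a w v < b w v) :=
  ⟨_, hb.sub ha, fun _ _ => Nat.sub_pos_iff_lt⟩

theorem not (h : EmitProp u p) : EmitProp u (fun w v => ¬ p w v) :=
  let ⟨f, hf, hp⟩ := h
  ⟨_, EmitNat.one.sub hf, fun w v =>
    (by omega : 0 < 1 - f w v ↔ ¬ 0 < f w v).trans (not_congr (hp w v))⟩

theorem and (h : EmitProp u p) (h' : EmitProp u q) : EmitProp u (fun w v => p w v ∧ q w v) :=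
  let ⟨_, hf, hp⟩ := h
  let ⟨_, hg, hq⟩ := h'
  ⟨_, hf.mul hg, fun w v => (by simp [Nat.pos_iff_ne_zero] : 0 < _ * _ ↔ 0 < _ ∧ 0 < _).trans
    (and_congr (hp w v) (hq w v))⟩

theorem le (ha : EmitNat u a) (hb : EmitNat u b) : EmitProp u (fun w v => a w v ≤ b w v) :=
  (lt hb ha).not.of_iff fun _ _ => not_lt

theorem eq (ha : EmitNat u a) (hb : EmitNat u b) : EmitProp u (fun w v => a w v = b w v) :=
  ((le ha hb).and (le hb ha)).of_iff fun _ _ => le_antisymm_iff.symm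

theorem existsLt {p : List Γ → ℕ → (Fin n → ℕ) → Prop} (hb : EmitNat u b)
    (h : EmitProp u fun w (v : Fin (n + 1) → ℕ) => p w (v 0) (Fin.tail v)) :
    EmitProp u (fun w v => ∃ i < b w v, p w i v) :=
  let ⟨f, hf, hp⟩ := h
  ⟨_, EmitNat.sum (f := fun w i v => f w (Fin.cons i v)) hb (hf.of_eq fun w v => by simp),
    fun w v => by simp [Finset.sum_pos_iff, hp]⟩

theorem forallLt {p : List Γ → ℕ → (Fin n → ℕ) → Prop} (hb : EmitNat u b)
    (h : EmitProp u fun w (v : Fin (n + 1) → ℕ) => p w (v 0) (Fin.tail v)) :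
    EmitProp u (fun w v => ∀ i < b w v, p w i v) :=
  (existsLt (p := fun w i v => ¬ p w i v) hb h.not).not.of_iff fun _ _ => by push Not; rfl

theorem inputAt (c : Γ) (ha : EmitNat u a) : EmitProp u (fun w v => w[a w v]? = some c) :=
  ⟨fun w v => if w[a w v]? = some c then 1 else 0,
    (Emit.inputAt c ha).of_eq fun w v => by dsimp only; split_ifs <;> rfl,
    fun w v => by dsimp only; split_ifs with h <;> simp [h]⟩

theorem eqInput {F : List Γ → (Fin n → ℕ) → List Γ} (hF : Emit u F) :
    EmitProp u (fun w v => F w v = w) :=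
  ⟨fun w v => if F w v = w then 1 else 0,
    (Emit.eqInput hF).of_eq fun w v => by dsimp only; split_ifs <;> rfl,
    fun w v => by dsimp only; split_ifs with h <;> simp [h]⟩

end EmitProp

/-- A conditional is two loops, of which one runs once and the other never: `1 - (1 - f)` and `1 -
f` are `1` and `0` in some order. -/
theorem Emit.ite {p : List Γ → (Fin n → ℕ) → Prop} [∀ w v, Decidable (p w v)]
    {F G : List Γ → (Fin n → ℕ) → List Γ} (hp : EmitProp u p) (hF : Emit u F) (hG : Emit u G) :
    Emit u (fun w v => if p w v then F w v else G w v) := by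
  obtain ⟨f, hf, hp⟩ := hp
  refine ((Emit.loop (F := fun w _ v => F w v) (EmitNat.one.sub (EmitNat.one.sub hf))
    hF.weaken).append (Emit.loop (F := fun w _ v => G w v) (EmitNat.one.sub hf)
    hG.weaken)).of_eq fun w v => ?_
  by_cases h : p w v
  · have := (hp w v).2 h
    simp [h, Nat.sub_eq_zero_of_le this]
  · have := mt (hp w v).1 h
    simp [h, show f w v = 0 by omega]

theorem Emit.nil : Emit u (fun _ (_ : Fin n → ℕ) => []) := EmitNat.const 0

namespace EmitNat

variable {a b : List Γ → (Fin n → ℕ) → ℕ}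

theorem ite {p : List Γ → (Fin n → ℕ) → Prop} [∀ w v, Decidable (p w v)] (hp : EmitProp u p)
    (ha : EmitNat u a) (hb : EmitNat u b) :
    EmitNat u (fun w v => if p w v then a w v else b w v) :=
  (Emit.ite hp ha hb).of_eq fun w v => by dsimp only; split_ifs <;> rfl

/-- For a positive divisor, the quotient counts the `i < a` with `(i + 1) * b ≤ a`; division by zero
is treated apart. -/
theorem div (ha : EmitNat u a) (hb : EmitNat u b) : EmitNat u (fun w v => a w v / b w v) := by
  refine (ite (EmitProp.eq hb (const 0)) (const 0) (sum (f := fun w i v =>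
    if (i + 1) * b w v ≤ a w v then 1 else 0) ha (ite (.le (((var 0).add one).mul hb.weaken)
    ha.weaken) one (const 0)))).of_eq fun w v => ?_
  split_ifs with h
  · simp [h]
  · simp only [← Nat.le_div_iff_mul_le (Nat.pos_of_ne_zero h), Nat.succ_le_iff]
    have : (Finset.range (a w v)).filter (· < a w v / b w v) =
        Finset.range (a w v / b w v) := by
      ext i
      have := Nat.div_le_self (a w v) (b w v)
      simp
      omega
    rw [← Finset.card_filter, this, Finset.card_range]

theorem pow (ha : EmitNat u a) (k : ℕ) : EmitNat u (fun w v => a w v ^ k) := by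
  induction k with
  | zero => exact (const 1).of_eq fun w v => by simp
  | succ k ih => exact ih.mul ha

theorem polynomial (P : Polynomial ℕ) (ha : EmitNat u a) :
    EmitNat u (fun w v => P.eval (a w v)) := by
  induction P using Polynomial.induction_on' with
  | add P Q hP hQ => exact (hP.add hQ).of_eq fun w v => by simp
  | monomial k c => exact ((const c).mul (ha.pow k)).of_eq fun w v => by simp

end EmitNat

end StackProgram

/-! ### Margins of profiles -/

section Margin

variable {m : ℕ}

theorem numPrefer_append (V W : List (Vote m)) (x y : Fin m) :
    numPrefer (V ++ W) x y = numPrefer V x y + numPrefer W x y :=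
  List.countP_append

theorem margin_append (V W : List (Vote m)) (x y : Fin m) :
    margin (V ++ W) x y = margin V x y + margin W x y := by
  simp only [margin, numPrefer_append]
  push_cast
  ring

theorem margin_self (V : List (Vote m)) (x : Fin m) : margin V x x = 0 := sub_self _

theorem margin_flatMap {α : Type*} (l : List α) (f : α → List (Vote m)) (x y : Fin m) :
    margin (l.flatMap f) x y = (l.map fun a => margin (f a) x y).sum := by
  induction l with
  | nil => rfl
  | cons a l ih => simp [margin_append, ih]

theorem margin_flatMap_finRange (f : Fin m → List (Vote m)) (x y : Fin m) :
    margin ((List.finRange m).flatMap f) x y = ∑ a, margin (f a) x y := by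
  rw [margin_flatMap, ← List.ofFn_eq_map, List.sum_ofFn]

theorem margin_singleton (v : Vote m) (x y : Fin m) :
    margin [v] x y = (if v.Prefers x y then 1 else 0) - (if v.Prefers y x then 1 else 0) := by
  simp only [margin, numPrefer, List.countP_singleton, decide_eq_true_eq]
  push_cast
  rfl

theorem margin_pair (v v' : Vote m) (x y : Fin m) :
    margin [v, v'] x y = margin [v] x y + margin [v'] x y :=
  margin_append [v] [v'] x y

/-- Votes are total. This forces every margin between distinct candidates to have the parity of the
number of votes. -/
theorem numPrefer_add_numPrefer (V : List (Vote m)) {x y : Fin m} (h : x ≠ y) :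
    numPrefer V x y + numPrefer V y x = V.length := by
  have := List.length_eq_countP_add_countP (fun v : Vote m => decide (v.Prefers x y)) (l := V)
  rw [this, numPrefer, numPrefer]
  congr 1
  refine List.countP_congr fun v _ => ?_
  have h' : v.symm x ≠ v.symm y := v.symm.injective.ne h
  rcases lt_or_gt_of_ne h' with h₁ | h₁ <;> simp [Vote.Prefers, h₁, not_lt_of_gt h₁]

theorem abs_margin_le (V : List (Vote m)) (x y : Fin m) : |margin V x y| ≤ V.length := by
  have h₁ : numPrefer V x y ≤ V.length := List.countP_le_length
  have h₂ : numPrefer V y x ≤ V.length := List.countP_le_length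
  rw [abs_le, margin]
  omega

theorem margin_one (x y : Fin m) :
    margin [(1 : Vote m)] x y = if x < y then 1 else if y < x then -1 else 0 := by
  rw [margin_singleton]
  change ((if x < y then 1 else 0) - if y < x then 1 else 0 : ℤ) = _
  split_ifs <;> first | rfl | omega

theorem margin_one_revPerm (x y : Fin m) :
    margin [(1 : Vote m), (Fin.revPerm : Vote m)] x y = 0 := by
  rw [margin_pair, margin_singleton, margin_singleton]
  have h (a b : Fin m) : Vote.Prefers (Fin.revPerm : Vote m) a b ↔ (1 : Vote m).Prefers b a := by
    change a.rev < b.rev ↔ b < a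
    exact Fin.rev_lt_rev
  simp only [h]
  ring

/-- A vote and the reverse of the same vote after exchanging its first two candidates: the margins
cancel, except between these two candidates. -/
theorem margin_mcGarvey (v : Vote m) {i j : Fin m} (hi : (i : ℕ) = 0) (hj : (j : ℕ) = 1)
    (x y : Fin m) :
    margin [v, v * Equiv.swap i j * Fin.revPerm] x y =
      (if x = v i ∧ y = v j then 2 else 0) - (if x = v j ∧ y = v i then 2 else 0) := by
  -- Candidates are replaced by their positions in `v`; then only positions `0`, `1` and at least
  -- `2` need to be told apart.
  obtain ⟨a, rfl⟩ := v.surjective x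
  obtain ⟨b, rfl⟩ := v.surjective y
  have h₁ (a b : Fin m) : v.Prefers (v a) (v b) ↔ a < b := by simp [Vote.Prefers]
  have h₂ (a b : Fin m) : Vote.Prefers (v * Equiv.swap i j * Fin.revPerm) (v a) (v b) ↔
      Equiv.swap i j b < Equiv.swap i j a := by
    rw [← Fin.rev_lt_rev]
    simp [Vote.Prefers, Equiv.Perm.mul_def]
  rw [margin_pair, margin_singleton, margin_singleton]
  have h₃ (a : Fin m) : (Equiv.swap i j a : ℕ) =
      if (a : ℕ) = 0 then (1 : ℕ) else if (a : ℕ) = 1 then (0 : ℕ) else (a : ℕ) := by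
    simp only [Equiv.swap_apply_def, Fin.ext_iff, hi, hj]
    split_ifs <;> simp_all
  simp only [h₁, h₂, v.injective.eq_iff, Fin.ext_iff, Fin.lt_def, h₃, hi, hj]
  generalize (a : ℕ) = a
  generalize (b : ℕ) = b
  rcases a with _ | _ | a <;> rcases b with _ | _ | b <;> simp

end Margin

/-! ### The reduced profile -/

section Reduction

variable {m : ℕ}

/-- The weight `d` capped for `t` manipulators. -/
def capNat (t d : ℕ) : ℕ :=
  if t < d then (if (d - (t + 1)) / 2 * 2 = d - (t + 1) then t + 1 else t + 2) else d

/-- The number of pairs of votes that realize the weight of the edge `(a, b)` when the candidates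
are in the order of the base votes (`lt`) or not. -/
def blockCount (t d : ℕ) (lt : Prop) [Decidable lt] : ℕ :=
  if lt then capNat t d / 2 else (capNat t d + 1) / 2

/-- A vote that starts with `a` and `b`. -/
def frontVote (h : 1 < m) (a b : Fin m) : Vote m :=
  Equiv.swap ⟨0, by omega⟩ a * Equiv.swap ⟨1, h⟩ (Equiv.swap ⟨0, by omega⟩ a b)

theorem frontVote_zero (h : 1 < m) {a b : Fin m} (hab : a ≠ b) :
    frontVote h a b ⟨0, by omega⟩ = a := by
  have h₁ : (⟨0, by omega⟩ : Fin m) ≠ Equiv.swap ⟨0, by omega⟩ a b := by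
    rw [Ne, eq_comm, Equiv.swap_apply_eq_iff, Equiv.swap_apply_left]
    exact hab.symm
  rw [frontVote, Equiv.Perm.mul_apply, Equiv.swap_apply_of_ne_of_ne _ h₁, Equiv.swap_apply_left]
  simp

theorem frontVote_one (h : 1 < m) (a b : Fin m) : frontVote h a b ⟨1, h⟩ = b := by
  simp [frontVote]

/-- Two votes whose only nonzero margins are between `a` and `b`. -/
def pairVotes (a b : Fin m) : List (Vote m) :=
  if h : 1 < m then
    [frontVote h a b, frontVote h a b * Equiv.swap ⟨0, by omega⟩ ⟨1, h⟩ * Fin.revPerm]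
  else []

theorem margin_pairVotes {a b : Fin m} (hab : a ≠ b) (x y : Fin m) :
    margin (pairVotes a b) x y =
      (if x = a ∧ y = b then 2 else 0) - (if x = b ∧ y = a then 2 else 0) := by
  have h : 1 < m := by omega
  rw [pairVotes, dif_pos h, margin_mcGarvey _ rfl rfl, frontVote_zero h hab, frontVote_one]

/-- One vote or two opposite votes, depending on the parity of `n`. -/
def baseVotes (m n : ℕ) : List (Vote m) :=
  if n / 2 * 2 = n then [1, Fin.revPerm] else [1]

/-- A profile with few votes whose margins are the capped margins of `V`. -/
def reducedVotes (t : ℕ) (V : List (Vote m)) : List (Vote m) :=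
  baseVotes m V.length ++ (List.finRange m).flatMap fun a => (List.finRange m).flatMap fun b =>
    if a = b then [] else (List.range (blockCount t (numPrefer V a b - numPrefer V b a)
      ((a : ℕ) < b))).flatMap fun _ => pairVotes a b

theorem capNat_mod_two (t d : ℕ) : capNat t d % 2 = d % 2 := by
  unfold capNat
  split_ifs <;> omega

theorem capWeight_natCast (t d : ℕ) : capWeight t d = capNat t d := by
  simp only [capWeight, capNat, Int.even_iff]
  split_ifs <;> omega

theorem capWeight_neg (t : ℕ) (w : ℤ) : capWeight t (-w) = -capWeight t w := by
  simp only [capWeight, Int.even_iff]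
  split_ifs <;> omega

theorem blockCount_zero (t : ℕ) (lt : Prop) [Decidable lt] : blockCount t 0 lt = 0 := by
  simp [blockCount, capNat]

/-- The first summand is the margin of the base votes, for a pair in their order and for a pair
against it. In the odd case it is `1` or `-1`, which is why `blockCount` rounds down or up.
Truncated subtraction makes at least one of the two counts vanish. -/
theorem capWeight_eq {t N N' L : ℕ} (h : N + N' = L) :
    capWeight t ((N : ℤ) - N') =
      (if L / 2 * 2 = L then 0 else 1) +
        (2 * (blockCount t (N - N') True : ℕ) - 2 * (blockCount t (N' - N) False : ℕ)) ∧
    capWeight t ((N : ℤ) - N') =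
      (if L / 2 * 2 = L then 0 else -1) +
        (2 * (blockCount t (N - N') False : ℕ) - 2 * (blockCount t (N' - N) True : ℕ)) := by
  rcases le_total N' N with hN | hN <;> obtain ⟨d, rfl⟩ := Nat.exists_eq_add_of_le hN
  · have h₁ : ((N' + d : ℕ) : ℤ) - N' = d := by simp
    have h₂ := capNat_mod_two t d
    rw [h₁, capWeight_natCast, Nat.sub_eq_zero_of_le hN, Nat.add_sub_cancel_left]
    simp only [blockCount_zero]
    simp only [blockCount, if_true, if_false]
    split_ifs <;> omega
  · have h₁ : (N : ℤ) - (N + d : ℕ) = -(d : ℤ) := by simp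
    have h₂ := capNat_mod_two t d
    rw [h₁, capWeight_neg, capWeight_natCast, Nat.sub_eq_zero_of_le hN, Nat.add_sub_cancel_left]
    simp only [blockCount_zero]
    simp only [blockCount, if_true, if_false]
    split_ifs <;> omega

theorem margin_reducedVotes (t : ℕ) (V : List (Vote m)) (x y : Fin m) :
    margin (reducedVotes t V) x y = capWeight t (margin V x y) := by
  rcases eq_or_ne x y with rfl | hxy
  · rw [margin_self, margin_self, capWeight, if_neg (by omega), if_neg (by omega)]
  set c : Fin m → Fin m → ℕ := fun a b =>
    blockCount t (numPrefer V a b - numPrefer V b a) ((a : ℕ) < b) with hc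
  have h₁ : margin (reducedVotes t V) x y =
      margin (baseVotes m V.length) x y + (2 * (c x y : ℤ) - 2 * (c y x : ℤ)) := by
    rw [reducedVotes, margin_append, margin_flatMap_finRange]
    congr 1
    -- Only the blocks of `(x, y)` and `(y, x)` contribute, so the double sum collapses to two
    -- terms.
    have h₂ (a b : Fin m) : margin (if a = b then [] else
        (List.range (blockCount t (numPrefer V a b - numPrefer V b a) ((a : ℕ) < b))).flatMap
          fun _ => pairVotes a b) x y =
        (if x = a ∧ y = b then 2 * (c a b : ℤ) else 0) -
          (if x = b ∧ y = a then 2 * (c a b : ℤ) else 0) := by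
      split_ifs with hab
      any_goals
        rw [margin_flatMap]
        simp [margin_pairVotes hab, *, mul_comm]
      all_goals first | rfl | omega
    simp only [margin_flatMap_finRange, h₂, Finset.sum_sub_distrib]
    congr 1
    · rw [Finset.sum_eq_single x, Finset.sum_eq_single y] <;> simp +contextual [eq_comm]
    · rw [Finset.sum_eq_single y, Finset.sum_eq_single x] <;> simp +contextual [eq_comm]
  rw [h₁, baseVotes]
  change _ = capWeight t ((numPrefer V x y : ℤ) - numPrefer V y x)
  have h := capWeight_eq (t := t) (numPrefer_add_numPrefer V hxy)
  rcases lt_or_gt_of_ne hxy with h' | h'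
  · have h'' : ¬ (y : ℕ) < x := by omega
    rw [h.1, hc]
    simp only [show (x : ℕ) < y from h', h'']
    split_ifs
    · rw [margin_one_revPerm]
    · rw [margin_one, if_pos h']
  · have h'' : ¬ (x : ℕ) < y := by omega
    rw [h.2, hc]
    simp only [show (y : ℕ) < x from h', h'']
    split_ifs
    · rw [margin_one_revPerm]
    · rw [margin_one, if_neg (by omega), if_pos h']

theorem length_flatMap_le {α β : Type*} (l : List α) (f : α → List β) (B : ℕ)
    (h : ∀ a, (f a).length ≤ B) : (l.flatMap f).length ≤ l.length * B := by
  rw [List.length_flatMap]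
  refine (List.sum_le_card_nsmul _ B fun x hx => ?_).trans (le_of_eq (by simp))
  obtain ⟨a, -, rfl⟩ := List.mem_map.1 hx
  exact h a

/-- A block has two votes per repetition and a capped weight is at most `t + 2`; rounding up gives
at most `t + 3` votes for each ordered pair. -/
theorem length_reducedVotes_le (t : ℕ) (V : List (Vote m)) :
    (reducedVotes t V).length ≤ 2 + m * (m * (t + 3)) := by
  rw [reducedVotes, List.length_append]
  refine add_le_add ?_ ?_
  · rw [baseVotes]
    split_ifs <;> simp
  refine (length_flatMap_le _ _ (m * (t + 3)) fun a => ?_).trans (by simp)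
  refine (length_flatMap_le _ _ (t + 3) fun b => ?_).trans (by simp)
  split_ifs
  · simp
  refine (length_flatMap_le _ _ 2 fun _ => ?_).trans ?_
  · rw [pairVotes]
    split_ifs <;> simp
  · rw [List.length_range]
    simp only [blockCount, capNat]
    split_ifs <;> omega

theorem reducedVotes_ne_nil (t : ℕ) (V : List (Vote m)) : 0 < (reducedVotes t V).length := by
  rw [reducedVotes, List.length_append, baseVotes]
  split_ifs <;> simp

/-! ### Size and equivalence of the reduced instance. -/

/-- The reduced instance. -/
def CMInstance.reduce (I : CMInstance m) : CMInstance m where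
  target := I.target
  votes := reducedVotes I.manipulators I.votes
  manipulators := I.manipulators
  voters_pos := Nat.add_pos_left (reducedVotes_ne_nil _ _) _

/-- With `T = max 1 t`, the base costs at most `2 * m ^ 2 * T`, the blocks `4 * m ^ 2 * T` since `t
+ 3 ≤ 4 * T`, and the manipulators `m ^ 2 * T`; the constant is `2 + 4 + 1`. -/
theorem CMInstance.numVotes_reduce_le (I : CMInstance m) :
    I.reduce.numVotes ≤ 7 * (m ^ 2 * max 1 I.manipulators) := by
  have h := length_reducedVotes_le I.manipulators I.votes
  have hm : 0 < m := I.target.pos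
  have h₁ : 1 ≤ max 1 I.manipulators := le_max_left _ _
  have h₂ : I.manipulators ≤ max 1 I.manipulators := le_max_right _ _
  change (reducedVotes I.manipulators I.votes).length + I.manipulators ≤ _
  generalize max 1 I.manipulators = T at h₁ h₂ ⊢
  have h₃ : m * (m * (I.manipulators + 3)) ≤ m ^ 2 * (4 * T) := by
    rw [← mul_assoc, ← sq]
    exact Nat.mul_le_mul_left _ (by omega)
  have h₄ : T ≤ m ^ 2 * T := Nat.le_mul_of_pos_left _ (by positivity)
  linarith

theorem copelandWinners_congr {V V' : List (Vote m)}
    (h : ∀ x y, 0 < margin V x y ↔ 0 < margin V' x y) : copelandWinners V = copelandWinners V' := by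
  have : copelandScore V = copelandScore V' := by
    funext x
    simp only [copelandScore, h]
  simp only [copelandWinners, this]

/-- The same manipulator votes work on both sides: they move a margin by at most `t`, too little to
change the sign of a margin that was capped. -/
theorem CMInstance.isYes_reduce (I : CMInstance m) : I.reduce.IsYes ↔ I.IsYes := by
  refine exists_congr fun W => and_congr_right fun hW => ?_
  rw [copelandWinners_congr (V := I.reduce.votes ++ W) (V' := I.votes ++ W)]
  · rfl
  intro x y
  have h₁ := abs_le.1 (abs_margin_le W x y)
  have hW : W.length = I.manipulators := hW
  rw [margin_append, margin_append,
    show margin I.reduce.votes x y = _ from margin_reducedVotes I.manipulators I.votes x y]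
  simp only [capWeight]
  split_ifs <;> omega

end Reduction

/-! ### Words that describe instances -/

/-- The alphabet of the words that describe instances together with their parameters. -/
abbrev InputSym : Type := CMSym ⊕ Bool

namespace InputSym

instance : LawfulBEq InputSym where
  eq_of_beq {a b} := (by decide : ∀ a b : InputSym, (a == b) = true → a = b) a b
  rfl {a} := (by decide : ∀ a : InputSym, (a == a) = true) a

abbrev tick : InputSym := Sum.inl CMSym.tick
abbrev comma : InputSym := Sum.inl CMSym.comma
abbrev semicolon : InputSym := Sum.inl CMSym.semicolon
abbrev mark : InputSym := Sum.inr true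

end InputSym

open InputSym

section Lists

variable {α β : Type*}

theorem List.flatMap_eq_flatMap_range (V : List α) (g : α → List β) (g' : ℕ → List β)
    (h : ∀ (r : ℕ) (hr : r < V.length), g V[r] = g' r) :
    V.flatMap g = (List.range V.length).flatMap g' := by
  induction V generalizing g' with
  | nil => rfl
  | cons a V ih =>
    rw [List.flatMap_cons, List.length_cons, List.range_succ_eq_map, List.flatMap_cons,
      List.flatMap_map, ← h 0 (by simp), ih (fun r => g' (r + 1)) fun r hr => h (r + 1) (by simpa)]
    rfl

theorem List.countP_eq_sum_range (V : List α) (p : α → Bool) (f : ℕ → ℕ)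
    (h : ∀ (r : ℕ) (hr : r < V.length), f r = if p V[r] then 1 else 0) :
    V.countP p = ∑ r ∈ Finset.range V.length, f r := by
  induction V generalizing f with
  | nil => rfl
  | cons a V ih =>
    rw [List.countP_cons, List.length_cons, Finset.sum_range_succ', h 0 (by simp),
      ih (fun r => f (r + 1)) fun r hr => h (r + 1) (by simpa)]
    rfl

theorem List.ofFn_val_eq_map_range {m : ℕ} {f : Fin m → ℕ} {g : ℕ → ℕ} (h : ∀ i, f i = g i) :
    List.ofFn f = (List.range m).map g := by
  refine List.ext_getElem (by simp) fun i h₁ h₂ => ?_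
  simp [h]

theorem List.count_take_eq_sum [BEq α] [LawfulBEq α] [DecidableEq α] (w : List α) (a : α) (i : ℕ) :
    (w.take i).count a = ∑ j ∈ Finset.range i, if w[j]? = some a then 1 else 0 := by
  induction i with
  | zero => simp
  | succ i ih =>
    rw [List.take_add_one, List.count_append, ih, Finset.sum_range_succ]
    congr 1
    cases w[i]? with
    | none => simp
    | some b => simp [List.count_singleton]

end Lists

/-- The row of a list of numbers. -/
def rowWord (l : List ℕ) : List InputSym := (encodeRow l).map Sum.inl

theorem rowWord_nil : rowWord [] = [semicolon] := rfl

theorem rowWord_cons (a : ℕ) (l : List ℕ) :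
    rowWord (a :: l) = List.replicate a tick ++ comma :: rowWord l := by
  simp [rowWord, encodeRow]

/-- The rows of the votes of a profile. -/
def votesWord {m : ℕ} (V : List (Vote m)) : List InputSym :=
  V.flatMap fun v => rowWord (List.ofFn fun i => (v i : ℕ))

/-- The word of an instance with `k` candidates and its parameter `k`. -/
def instanceWord (k target : ℕ) (votes : List InputSym) (t : ℕ) : List InputSym :=
  rowWord [k, target] ++ (votes ++ (List.replicate t semicolon ++ List.replicate k mark))

theorem unaryEncodeNat_eq (k : ℕ) : Computability.unaryEncodeNat k = List.replicate k true := by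
  induction k with
  | zero => rfl
  | succ k ih => rw [Computability.unaryEncodeNat, ih, List.replicate_succ]

theorem pairEncoding_encode (x : List CMSym) (k : ℕ) :
    (pairEncoding CMSym).encode (x, k) = x.map Sum.inl ++ List.replicate k mark := by
  simp [pairEncoding, Computability.encodingProd, Computability.encodingList,
    Computability.unaryEncodingNat, unaryEncodeNat_eq]

theorem CMInstance.encode_eq_instanceWord {m : ℕ} (I : CMInstance m) :
    (pairEncoding CMSym).encode (I.encode, m) =
      instanceWord m I.target (votesWord I.votes) I.manipulators := by
  rw [pairEncoding_encode]
  have h (t : ℕ) : ((List.replicate t (encodeRow [])).flatten).map Sum.inl =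
      List.replicate t semicolon := by
    simp [encodeRow, List.flatten_replicate_singleton]
  simp [instanceWord, CMInstance.encode, rowWord, votesWord, List.map_flatMap, h]

/-! ### Decoding words by counting separators. -/

/-- The number of ticks of `w` that are preceded by exactly `c` commas. -/
def field (w : List InputSym) (c : ℕ) : ℕ :=
  ∑ i ∈ Finset.range w.length, if w[i]? = some tick ∧ (w.take i).count comma = c then 1 else 0

theorem field_tick (w : List InputSym) (c : ℕ) :
    field (tick :: w) c = field w c + if c = 0 then 1 else 0 := by
  rw [field, List.length_cons, Finset.sum_range_succ']
  congr 1
  simp [eq_comm]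

theorem field_comma_zero (w : List InputSym) : field (comma :: w) 0 = 0 := by
  rw [field, List.length_cons, Finset.sum_range_succ']
  simp

theorem field_comma_succ (w : List InputSym) (c : ℕ) : field (comma :: w) (c + 1) = field w c := by
  rw [field, List.length_cons, Finset.sum_range_succ']
  simp [field]

theorem field_semicolon (w : List InputSym) (c : ℕ) : field (semicolon :: w) c = field w c := by
  rw [field, List.length_cons, Finset.sum_range_succ']
  simp [field]

theorem field_number_zero (a : ℕ) (w : List InputSym) :
    field (List.replicate a tick ++ comma :: w) 0 = a := by
  induction a with
  | zero => exact field_comma_zero w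
  | succ a ih => rw [List.replicate_succ, List.cons_append, field_tick, ih, if_pos rfl]

theorem field_number_succ (a : ℕ) (w : List InputSym) (c : ℕ) :
    field (List.replicate a tick ++ comma :: w) (c + 1) = field w c := by
  induction a with
  | zero => exact field_comma_succ w c
  | succ a ih => rw [List.replicate_succ, List.cons_append, field_tick, ih]; rfl

theorem field_rowWord (l : List ℕ) (w : List InputSym) (c : ℕ) (hc : c < l.length) :
    field (rowWord l ++ w) c = l[c] := by
  induction l generalizing c with
  | nil => simp at hc
  | cons a l ih =>
    rw [rowWord_cons, List.append_assoc, List.cons_append]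
    cases c with
    | zero => exact field_number_zero a _
    | succ c => rw [field_number_succ, ih c (by simpa using hc)]; rfl

/-- A row has one comma per entry, so skipping it shifts the field index by its length. Hence entry
`j` of vote `r` sits at `r * m + j` after the header. -/
theorem field_rowWord_add (l : List ℕ) (w : List InputSym) (c : ℕ) :
    field (rowWord l ++ w) (l.length + c) = field w c := by
  induction l with
  | nil => rw [rowWord_nil, List.singleton_append, field_semicolon]; simp
  | cons a l ih =>
    rw [rowWord_cons, List.append_assoc, List.cons_append, List.length_cons, add_right_comm,
      field_number_succ, ih]

theorem field_votesWord {m : ℕ} (V : List (Vote m)) (w : List InputSym) (r : ℕ)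
    (hr : r < V.length) (j : Fin m) : field (votesWord V ++ w) (r * m + j) = V[r] j := by
  induction V generalizing r with
  | nil => simp at hr
  | cons v V ih =>
    rw [votesWord, List.flatMap_cons, List.append_assoc]
    cases r with
    | zero => rw [zero_mul, zero_add, field_rowWord _ _ _ (by simp)]; simp
    | succ r =>
      have h := field_rowWord_add (List.ofFn fun i => (v i : ℕ)) (votesWord V ++ w) (r * m + j)
      rw [List.length_ofFn] at h
      rw [show (r + 1) * m + j = m + (r * m + j) by ring]
      exact h.trans (ih r (by simpa using hr))

theorem count_comma_rowWord (l : List ℕ) : (rowWord l).count comma = l.length := by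
  induction l with
  | nil => rfl
  | cons a l ih => simp [rowWord_cons, ih, List.count_replicate]

theorem count_semicolon_rowWord (l : List ℕ) : (rowWord l).count semicolon = 1 := by
  induction l with
  | nil => rfl
  | cons a l ih => simp [rowWord_cons, ih, List.count_replicate]

theorem count_comma_votesWord {m : ℕ} (V : List (Vote m)) :
    (votesWord V).count comma = V.length * m := by
  induction V with
  | nil => simp [votesWord]
  | cons v V ih =>
    rw [votesWord, List.flatMap_cons, List.count_append, ← votesWord, ih, count_comma_rowWord]
    simp
    ring

theorem count_semicolon_votesWord {m : ℕ} (V : List (Vote m)) :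
    (votesWord V).count semicolon = V.length := by
  induction V with
  | nil => simp [votesWord]
  | cons v V ih =>
    rw [votesWord, List.flatMap_cons, List.count_append, ← votesWord, ih, count_semicolon_rowWord]
    simp
    ring

theorem count_mark_encode (x : List CMSym) (k : ℕ) :
    ((pairEncoding CMSym).encode (x, k)).count mark = k := by
  rw [pairEncoding_encode, List.count_append, List.count_replicate_self,
    List.count_eq_zero_of_not_mem (by simp), zero_add]

/-- The number of candidates that a word announces by its parameter. -/
def numCandidates (w : List InputSym) : ℕ := w.count mark

/-- The number of votes of non-manipulators in a word. -/
def numVotesOf (w : List InputSym) : ℕ := (w.count comma - 2) / numCandidates w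

/-- The number of manipulators in a word. -/
def numManipulators (w : List InputSym) : ℕ := w.count semicolon - 1 - numVotesOf w

/-- The `j`-th entry of the `r`-th vote in a word. -/
def voteEntry (w : List InputSym) (r j : ℕ) : ℕ := field w (2 + (r * numCandidates w + j))

section Decode

variable {m : ℕ} (I : CMInstance m)

theorem numCandidates_encode (x : List CMSym) (k : ℕ) :
    numCandidates ((pairEncoding CMSym).encode (x, k)) = k :=
  count_mark_encode x k

/-- There are two commas in the header and `m` in each vote; division by `m` is sound because the
target witnesses `0 < m`. -/
theorem numVotesOf_encode :
    numVotesOf ((pairEncoding CMSym).encode (I.encode, m)) = I.votes.length := by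
  rw [numVotesOf, numCandidates_encode, I.encode_eq_instanceWord]
  simp [instanceWord, count_comma_rowWord, count_comma_votesWord, List.count_replicate,
    Nat.mul_div_cancel _ I.target.pos]

theorem numManipulators_encode :
    numManipulators ((pairEncoding CMSym).encode (I.encode, m)) = I.manipulators := by
  rw [numManipulators, numVotesOf_encode, I.encode_eq_instanceWord]
  simp [instanceWord, count_semicolon_rowWord, count_semicolon_votesWord, List.count_replicate]

theorem field_one_encode :
    field ((pairEncoding CMSym).encode (I.encode, m)) 1 = I.target := by
  rw [I.encode_eq_instanceWord, instanceWord, field_rowWord _ _ _ (by simp)]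
  rfl

theorem voteEntry_encode {r : ℕ} (hr : r < I.votes.length) (j : Fin m) :
    voteEntry ((pairEncoding CMSym).encode (I.encode, m)) r j = I.votes[r] j := by
  rw [voteEntry, numCandidates_encode, I.encode_eq_instanceWord, instanceWord]
  exact (field_rowWord_add [m, (I.target : ℕ)] _ _).trans (field_votesWord _ _ r hr j)

/-- Every component is recovered by the decoding functions. This pins down the instance that
`kernelize` chooses. -/
theorem CMInstance.encode_injective : Function.Injective (CMInstance.encode (m := m)) := by
  intro I J h
  have h₁ := field_one_encode I
  have h₂ := numManipulators_encode I
  have h₃ := numVotesOf_encode I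
  have h₄ := @voteEntry_encode _ I
  rw [h, field_one_encode, Fin.val_inj] at h₁
  rw [h, numManipulators_encode] at h₂
  rw [h, numVotesOf_encode] at h₃
  have h₅ : I.votes = J.votes := by
    refine List.ext_getElem h₃.symm fun r hr hr' => Equiv.ext fun j => Fin.val_injective ?_
    rw [← h₄ hr j, h, voteEntry_encode J hr']
  cases I
  cases J
  simp_all

end Decode

/-! ### The kernelization as a program of bounded loops -/

open InputSym StackProgram

/-- The row of a vote that is given by a function on numbers. -/
def voteWord (g : ℕ → ℕ) (k : ℕ) : List InputSym := rowWord ((List.range k).map g)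

theorem rowWord_ofFn {m : ℕ} (v : Vote m) (g : ℕ → ℕ) (h : ∀ i, (v i : ℕ) = g i) :
    rowWord (List.ofFn fun i => (v i : ℕ)) = voteWord g m := by
  rw [voteWord, List.ofFn_val_eq_map_range h]

/-- The rows of the votes in a word, decoded and written again. -/
def recodedVotes (w : List InputSym) : List InputSym :=
  (List.range (numVotesOf w)).flatMap fun r => voteWord (voteEntry w r) (numCandidates w)

theorem recodedVotes_encode {m : ℕ} (I : CMInstance m) :
    recodedVotes ((pairEncoding CMSym).encode (I.encode, m)) = votesWord I.votes := by
  rw [recodedVotes, numVotesOf_encode, numCandidates_encode, votesWord]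
  exact (List.flatMap_eq_flatMap_range _ _ _ fun r hr => rowWord_ofFn _ _ fun i =>
    (voteEntry_encode I hr i).symm).symm

/-- The word describes an instance with at most `p m` manipulators. -/
def IsInstanceWord (p : Polynomial ℕ) (w : List InputSym) : Prop :=
  (field w 1 < numCandidates w ∧ 0 < numVotesOf w + numManipulators w) ∧
  (numManipulators w ≤ p.eval (numCandidates w) ∧
  ((∀ r < numVotesOf w, ∀ j < numCandidates w,
    voteEntry w r j < numCandidates w ∧ ∀ i < j, ¬ voteEntry w r i = voteEntry w r j) ∧
  instanceWord (numCandidates w) (field w 1) (recodedVotes w) (numManipulators w) = w))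

theorem isInstanceWord_encode {m : ℕ} (p : Polynomial ℕ) (I : CMInstance m)
    (hI : I.manipulators ≤ p.eval m) :
    IsInstanceWord p ((pairEncoding CMSym).encode (I.encode, m)) := by
  rw [IsInstanceWord, numCandidates_encode, numVotesOf_encode, numManipulators_encode,
    field_one_encode, recodedVotes_encode]
  refine ⟨⟨I.target.2, I.voters_pos⟩, hI, fun r hr j hj => ?_, I.encode_eq_instanceWord.symm⟩
  have h := voteEntry_encode I hr ⟨j, hj⟩
  refine ⟨h ▸ Fin.is_lt _, fun i hi => ?_⟩
  have h' := voteEntry_encode I hr ⟨i, hi.trans hj⟩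
  dsimp only at h h'
  rw [h, h', Fin.val_inj, Equiv.apply_eq_iff_eq, Fin.mk.injEq]
  exact hi.ne

/-- Decoding is total, so syntax errors show only in the comparison of the word with the encoding of
its decoded data. Distinct entries below `k` give an injective self-map of `Fin k`, hence a vote. -/
theorem exists_of_isInstanceWord {p : Polynomial ℕ} {x : List CMSym} {k : ℕ}
    (h : IsInstanceWord p ((pairEncoding CMSym).encode (x, k))) :
    ∃ I : CMInstance k, I.encode = x ∧ I.manipulators ≤ p.eval k := by
  rw [IsInstanceWord, recodedVotes, numCandidates_encode] at h
  generalize hw : (pairEncoding CMSym).encode (x, k) = w at h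
  obtain ⟨⟨htarget, hpos⟩, hman, hvotes, heq⟩ := h
  have hinj (r : Fin (numVotesOf w)) : Function.Injective fun j : Fin k =>
      (⟨voteEntry w r j, (hvotes r r.2 j j.2).1⟩ : Fin k) := by
    intro i j hij
    rw [Fin.mk.injEq] at hij
    rcases lt_trichotomy i j with h | h | h
    · exact absurd hij ((hvotes r r.2 j j.2).2 i h)
    · exact h
    · exact absurd hij.symm ((hvotes r r.2 i i.2).2 j h)
  let V : List (Vote k) := List.ofFn fun r : Fin (numVotesOf w) =>
    Equiv.ofBijective _ (Finite.injective_iff_bijective.1 (hinj r))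
  have hV : V.length = numVotesOf w := List.length_ofFn
  let I : CMInstance k :=
    { target := ⟨field w 1, htarget⟩, votes := V, manipulators := numManipulators w,
      voters_pos := by rwa [hV] }
  have hI : (pairEncoding CMSym).encode (I.encode, k) = (pairEncoding CMSym).encode (x, k) := by
    rw [hw, I.encode_eq_instanceWord]
    refine Eq.trans ?_ heq
    have : votesWord V = (List.range (numVotesOf w)).flatMap fun r =>
        voteWord (voteEntry w r) k := by
      rw [← hV]
      refine List.flatMap_eq_flatMap_range _ _ _ fun r hr => rowWord_ofFn _ _ fun i => ?_
      simp [V]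
    change instanceWord k (field w 1) (votesWord V) (numManipulators w) = _
    rw [this]
  exact ⟨I, congrArg Prod.fst ((pairEncoding CMSym).encode_injective hI), hman⟩

/-! ### The reduced profile of a word -/

/-- The number of votes in a word that prefer `a` to `b`. -/
def numPreferOf (w : List InputSym) (a b : ℕ) : ℕ :=
  ∑ r ∈ Finset.range (numVotesOf w),
    if ∃ j < numCandidates w, ∃ i < j, voteEntry w r i = a ∧ voteEntry w r j = b then 1 else 0

theorem numPreferOf_encode {m : ℕ} (I : CMInstance m) (a b : Fin m) :
    numPreferOf ((pairEncoding CMSym).encode (I.encode, m)) a b = numPrefer I.votes a b := by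
  rw [numPreferOf, numVotesOf_encode, numCandidates_encode]
  refine (List.countP_eq_sum_range _ _ _ fun r hr => ?_).symm
  refine if_congr ?_ rfl rfl
  rw [decide_eq_true_eq, Vote.Prefers]
  have h (i : Fin m) (a : Fin m) :
      voteEntry ((pairEncoding CMSym).encode (I.encode, m)) r i = a ↔ i = I.votes[r].symm a := by
    rw [voteEntry_encode I hr, Fin.val_inj, Equiv.eq_symm_apply]
  constructor
  · rintro ⟨j, hj, i, hi, hia, hjb⟩
    rw [← (h ⟨j, hj⟩ b).1 hjb, ← (h ⟨i, hi.trans hj⟩ a).1 hia]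
    exact hi
  · intro hlt
    exact ⟨_, (I.votes[r].symm b).2, _, hlt, (h _ a).2 rfl, (h _ b).2 rfl⟩

/-- The candidates of the vote `frontVote`. -/
def frontEntry (a b j : ℕ) : ℕ := Equiv.swap 0 a (Equiv.swap 1 (Equiv.swap 0 a b) j)

/-- Transpositions commute with the passage to numbers, so the votes of a block can be printed
without reference to `Fin m`. -/
theorem Fin.val_swap {m : ℕ} (i j x : Fin m) :
    (Equiv.swap i j x : ℕ) = Equiv.swap (i : ℕ) (j : ℕ) (x : ℕ) := by
  simp only [Equiv.swap_apply_def, Fin.ext_iff]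
  split_ifs <;> rfl

/-- The rows of the votes `pairVotes`. -/
def pairWord (k a b : ℕ) : List InputSym :=
  voteWord (frontEntry a b) k ++ voteWord (fun j => frontEntry a b (Equiv.swap 0 1 (k - 1 - j))) k

theorem votesWord_pairVotes {m : ℕ} {a b : Fin m} (hab : a ≠ b) :
    votesWord (pairVotes a b) = pairWord m a b := by
  have h : 1 < m := by omega
  have hf (j : Fin m) : (frontVote h a b j : ℕ) = frontEntry a b j := by
    simp [frontVote, frontEntry, Fin.val_swap]
  rw [pairVotes, dif_pos h, pairWord]
  simp only [votesWord, List.flatMap_cons, List.flatMap_nil, List.append_nil]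
  rw [rowWord_ofFn _ _ hf, rowWord_ofFn _ _ fun j => ?_]
  have : m - (j + 1) = m - 1 - (j : ℕ) := by omega
  simp [hf, Fin.val_swap, Fin.revPerm, this]

/-- The rows of the votes of the reduced instance of a word. -/
def reducedWord (w : List InputSym) : List InputSym :=
  (if numVotesOf w / 2 * 2 = numVotesOf w then
    voteWord id (numCandidates w) ++ voteWord (fun j => numCandidates w - 1 - j) (numCandidates w)
  else voteWord id (numCandidates w)) ++
  (List.range (numCandidates w)).flatMap fun a => (List.range (numCandidates w)).flatMap fun b =>
    if a = b then [] else
      (List.range (blockCount (numManipulators w) (numPreferOf w a b - numPreferOf w b a)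
        (a < b))).flatMap fun _ => pairWord (numCandidates w) a b

theorem votesWord_baseVotes (m n : ℕ) : votesWord (baseVotes m n) =
    if n / 2 * 2 = n then voteWord id m ++ voteWord (fun j => m - 1 - j) m
    else voteWord id m := by
  have h₁ : rowWord (List.ofFn fun i => ((1 : Vote m) i : ℕ)) = voteWord id m :=
    rowWord_ofFn _ _ fun _ => rfl
  have h₂ : rowWord (List.ofFn fun i => ((Fin.revPerm : Vote m) i : ℕ)) =
      voteWord (fun j => m - 1 - j) m :=
    rowWord_ofFn _ _ fun i => by
      have : m - (i + 1) = m - 1 - (i : ℕ) := by omega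
      simp [Fin.revPerm, this]
  rw [baseVotes]
  split_ifs
  · rw [← h₁, ← h₂]
    simp [votesWord]
  · rw [← h₁]
    simp [votesWord]

theorem votesWord_flatMap {m : ℕ} {α : Type*} (l : List α) (f : α → List (Vote m)) :
    votesWord (l.flatMap f) = l.flatMap fun a => votesWord (f a) :=
  List.flatMap_assoc

theorem List.finRange_flatMap {β : Type*} {m : ℕ} (g : Fin m → List β) (g' : ℕ → List β)
    (h : ∀ i, g i = g' i) : (List.finRange m).flatMap g = (List.range m).flatMap g' := by
  have := List.flatMap_eq_flatMap_range (List.finRange m) g g' fun r hr => by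
    rw [h, List.getElem_finRange]
    rfl
  rwa [List.length_finRange] at this

theorem reducedWord_encode {m : ℕ} (I : CMInstance m) :
    reducedWord ((pairEncoding CMSym).encode (I.encode, m)) = votesWord I.reduce.votes := by
  change _ = votesWord (reducedVotes I.manipulators I.votes)
  rw [reducedWord, numVotesOf_encode, numCandidates_encode, numManipulators_encode, reducedVotes,
    votesWord, List.flatMap_append, ← votesWord, ← votesWord, votesWord_baseVotes,
    votesWord_flatMap]
  congr 1
  refine (List.finRange_flatMap _ _ fun a => ?_).symm
  rw [votesWord_flatMap]
  refine List.finRange_flatMap _ _ fun b => ?_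
  simp only [Fin.val_inj, numPreferOf_encode]
  split_ifs with hab
  · rfl
  · rw [votesWord_flatMap]
    simp only [votesWord_pairVotes hab]

open Classical in
/-- The word of the reduced instance, or the word of a trivial no-instance. -/
noncomputable def kernelWord (p : Polynomial ℕ) (w : List InputSym) : List InputSym :=
  if IsInstanceWord p w then
    instanceWord (numCandidates w) (field w 1) (reducedWord w) (numManipulators w)
  else List.replicate (numCandidates w) mark

theorem kernelWord_encode {m : ℕ} (p : Polynomial ℕ) (I : CMInstance m)
    (hI : I.manipulators ≤ p.eval m) :
    kernelWord p ((pairEncoding CMSym).encode (I.encode, m)) =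
      (pairEncoding CMSym).encode (I.reduce.encode, m) := by
  rw [kernelWord, if_pos (isInstanceWord_encode p I hI), I.reduce.encode_eq_instanceWord,
    numCandidates_encode, field_one_encode, reducedWord_encode, numManipulators_encode]
  rfl

theorem kernelWord_of_not_exists {p : Polynomial ℕ} {x : List CMSym} {k : ℕ}
    (h : ¬ ∃ I : CMInstance k, I.encode = x ∧ I.manipulators ≤ p.eval k) :
    kernelWord p ((pairEncoding CMSym).encode (x, k)) = (pairEncoding CMSym).encode ([], k) := by
  rw [kernelWord, if_neg (mt exists_of_isInstanceWord h), numCandidates_encode,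
    pairEncoding_encode]
  rfl

/-! ### Emission of the kernel -/

namespace StackProgram

variable {n : ℕ}

theorem Emit.replicate {a : List InputSym → (Fin n → ℕ) → ℕ} (s : InputSym)
    (ha : EmitNat tick a) : Emit tick (fun w v => List.replicate (a w v) s) :=
  (Emit.loop (F := fun _ _ _ => [s]) ha (.sym s)).of_eq fun w v => by
    induction a w v with
    | zero => rfl
    | succ k ih => rw [List.range_succ, List.flatMap_append, ih, List.replicate_succ']; rfl

theorem EmitNat.countTake {a : List InputSym → (Fin n → ℕ) → ℕ} (s : InputSym)
    (ha : EmitNat tick a) : EmitNat tick (fun w v => (w.take (a w v)).count s) :=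
  (EmitNat.sum (f := fun w i _ => if w[i]? = some s then 1 else 0) ha
    (.ite (.inputAt s (.var 0)) .one (.const 0))).of_eq fun w _ =>
    (List.count_take_eq_sum w s _).symm

theorem EmitNat.count (s : InputSym) : EmitNat tick (fun w (_ : Fin n → ℕ) => w.count s) :=
  (EmitNat.length.countTake s).of_eq fun w _ => by rw [List.take_length]

theorem EmitNat.field {c : List InputSym → (Fin n → ℕ) → ℕ} (hc : EmitNat tick c) :
    EmitNat tick (fun w v => field w (c w v)) :=
  EmitNat.sum (f := fun w i v =>
      if w[i]? = some tick ∧ (w.take i).count comma = c w v then 1 else 0) .length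
    (.ite (.and (.inputAt tick (.var 0)) (.eq ((EmitNat.var 0).countTake comma) hc.weaken))
      .one (.const 0))

theorem EmitNat.numCandidates : EmitNat tick (fun w (_ : Fin n → ℕ) => numCandidates w) :=
  .count mark

theorem EmitNat.numVotesOf : EmitNat tick (fun w (_ : Fin n → ℕ) => numVotesOf w) :=
  .div (.sub (.count comma) (.const 2)) .numCandidates

theorem EmitNat.numManipulators : EmitNat tick (fun w (_ : Fin n → ℕ) => numManipulators w) :=
  .sub (.sub (.count semicolon) .one) .numVotesOf

theorem EmitNat.voteEntry {r j : List InputSym → (Fin n → ℕ) → ℕ} (hr : EmitNat tick r)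
    (hj : EmitNat tick j) : EmitNat tick (fun w v => voteEntry w (r w v) (j w v)) :=
  .field (.add (.const 2) (.add (.mul hr .numCandidates) hj))

theorem EmitNat.numPreferOf {a b : List InputSym → (Fin n → ℕ) → ℕ} (ha : EmitNat tick a)
    (hb : EmitNat tick b) : EmitNat tick (fun w v => numPreferOf w (a w v) (b w v)) :=
  EmitNat.sum (f := fun w r v => if ∃ j < _root_.numCandidates w, ∃ i < j,
      _root_.voteEntry w r i = a w v ∧ _root_.voteEntry w r j = b w v then 1 else 0) .numVotesOf
    -- In the innermost scope the variables `0`, `1`, `2` are `i`, `j`, `r`; each `weaken` leaves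
    -- one scope.
    (.ite (.existsLt (p := fun w j v => ∃ i < j, _root_.voteEntry w (v 0) i = a w (Fin.tail v) ∧
        _root_.voteEntry w (v 0) j = b w (Fin.tail v)) .numCandidates
      (.existsLt (p := fun w i v => _root_.voteEntry w (Fin.tail v 0) i = a w (Fin.tail (Fin.tail v))
        ∧ _root_.voteEntry w (Fin.tail v 0) (v 0) = b w (Fin.tail (Fin.tail v))) (.var 0)
        (.and (.eq (.voteEntry (.weaken (.weaken (.var 0))) (.var 0)) ha.weaken.weaken.weaken)
          (.eq (.voteEntry (.weaken (.weaken (.var 0))) (.weaken (.var 0)))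
            hb.weaken.weaken.weaken)))) .one (.const 0))

theorem EmitNat.swap {a b c : List InputSym → (Fin n → ℕ) → ℕ} (ha : EmitNat tick a)
    (hb : EmitNat tick b) (hc : EmitNat tick c) :
    EmitNat tick (fun w v => Equiv.swap (a w v) (b w v) (c w v)) :=
  (EmitNat.ite (.eq hc ha) hb (.ite (.eq hc hb) ha hc)).of_eq fun _ _ =>
    (Equiv.swap_apply_def _ _ _).symm

theorem EmitNat.frontEntry {a b j : List InputSym → (Fin n → ℕ) → ℕ} (ha : EmitNat tick a)
    (hb : EmitNat tick b) (hj : EmitNat tick j) :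
    EmitNat tick (fun w v => frontEntry (a w v) (b w v) (j w v)) :=
  .swap (.const 0) ha (.swap .one (.swap (.const 0) ha hb) hj)

theorem EmitNat.capNat {t d : List InputSym → (Fin n → ℕ) → ℕ} (ht : EmitNat tick t)
    (hd : EmitNat tick d) : EmitNat tick (fun w v => capNat (t w v) (d w v)) :=
  .ite (.lt ht hd) (.ite (.eq (.mul (.div (.sub hd (.add ht .one)) (.const 2)) (.const 2))
    (.sub hd (.add ht .one))) (.add ht .one) (.add ht (.const 2))) hd

theorem EmitNat.blockCount {t d : List InputSym → (Fin n → ℕ) → ℕ}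
    {p : List InputSym → (Fin n → ℕ) → Prop} [∀ w v, Decidable (p w v)] (ht : EmitNat tick t)
    (hd : EmitNat tick d) (hp : EmitProp tick p) :
    EmitNat tick (fun w v => blockCount (t w v) (d w v) (p w v)) :=
  .ite hp (.div (.capNat ht hd) (.const 2)) (.div (.add (.capNat ht hd) .one) (.const 2))

theorem Emit.voteWord {g : List InputSym → ℕ → (Fin n → ℕ) → ℕ}
    (hg : EmitNat tick fun w (v : Fin (n + 1) → ℕ) => g w (v 0) (Fin.tail v)) :
    Emit tick (fun w v => voteWord (fun j => g w j v) (numCandidates w)) :=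
  (Emit.append (Emit.loop (F := fun w j v => List.replicate (g w j v) tick ++ [comma])
    EmitNat.numCandidates (.append hg (.sym comma))) (.sym semicolon)).of_eq fun w v => by
      simp [_root_.voteWord, rowWord, encodeRow, List.flatMap_map, List.map_flatMap]

theorem Emit.pairWord {a b : List InputSym → (Fin n → ℕ) → ℕ} (ha : EmitNat tick a)
    (hb : EmitNat tick b) :
    Emit tick (fun w v => pairWord (numCandidates w) (a w v) (b w v)) :=
  .append (.voteWord (.frontEntry ha.weaken hb.weaken (.var 0)))
    (.voteWord (g := fun w j v => frontEntry (a w v) (b w v)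
        (Equiv.swap 0 1 (numCandidates w - 1 - j)))
      (.frontEntry ha.weaken hb.weaken (.swap (.const 0) .one
        (.sub (.sub .numCandidates .one) (.var 0)))))

theorem Emit.recodedVotes : Emit tick (fun w (_ : Fin n → ℕ) => recodedVotes w) :=
  Emit.loop (F := fun w r _ => _root_.voteWord (voteEntry w r) (numCandidates w)) EmitNat.numVotesOf
    (.voteWord (g := fun w j v => voteEntry w (v 0) j)
      (EmitNat.voteEntry (EmitNat.weaken (EmitNat.var 0)) (.var 0)))

theorem Emit.reducedWord : Emit tick (fun w (_ : Fin n → ℕ) => reducedWord w) :=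
  .append
    (.ite (.eq (.mul (.div .numVotesOf (.const 2)) (.const 2)) .numVotesOf)
      (.append (.voteWord (g := fun _ j _ => j) (.var 0))
        (.voteWord (g := fun w j _ => numCandidates w - 1 - j)
          (.sub (.sub .numCandidates .one) (.var 0))))
      (.voteWord (g := fun _ j _ => j) (.var 0)))
    (Emit.loop (F := fun w a _ => (List.range (numCandidates w)).flatMap fun b =>
        if a = b then [] else (List.range (blockCount (numManipulators w)
          (numPreferOf w a b - numPreferOf w b a) (a < b))).flatMap fun _ =>
            _root_.pairWord (numCandidates w) a b) EmitNat.numCandidates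
      (Emit.loop (F := fun w b v => if v 0 = b then [] else
          (List.range (blockCount (numManipulators w)
            (numPreferOf w (v 0) b - numPreferOf w b (v 0)) (v 0 < b))).flatMap fun _ =>
              _root_.pairWord (numCandidates w) (v 0) b) EmitNat.numCandidates
        (.ite (.eq (.weaken (.var 0)) (.var 0)) .nil
          (Emit.loop (F := fun w _ v => _root_.pairWord (numCandidates w) (Fin.tail v 0) (v 0))
            (EmitNat.blockCount .numManipulators
              (.sub (.numPreferOf (.weaken (.var 0)) (.var 0))
                (.numPreferOf (.var 0) (.weaken (.var 0))))
              (.lt (.weaken (.var 0)) (.var 0)))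
            (.pairWord (.weaken (.weaken (.var 0))) (.weaken (.var 0)))))))

theorem Emit.instanceWord {F : List InputSym → (Fin n → ℕ) → List InputSym} (hF : Emit tick F) :
    Emit tick (fun w v =>
      instanceWord (numCandidates w) (field w 1) (F w v) (numManipulators w)) :=
  (Emit.append (Emit.append EmitNat.numCandidates (Emit.append (.sym comma) (Emit.append
    (EmitNat.field .one) (.append (.sym comma) (.sym semicolon))))) (.append hF (.append
      (.replicate semicolon .numManipulators) (.replicate mark .numCandidates)))).of_eq
    fun w v => by simp [_root_.instanceWord, rowWord_cons, rowWord_nil]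

theorem EmitProp.isInstanceWord (p : Polynomial ℕ) :
    EmitProp tick (fun w (_ : Fin n → ℕ) => IsInstanceWord p w) :=
  .and (.and (.lt (.field .one) .numCandidates)
      (.lt (.const 0) (.add .numVotesOf .numManipulators)))
    (.and (.le .numManipulators (.polynomial p .numCandidates))
      (.and (.forallLt (p := fun w r _ => ∀ j < numCandidates w,
            voteEntry w r j < numCandidates w ∧ ∀ i < j, ¬ voteEntry w r i = voteEntry w r j)
          .numVotesOf
          (.forallLt (p := fun w j v => voteEntry w (v 0) j < numCandidates w ∧
              ∀ i < j, ¬ voteEntry w (v 0) i = voteEntry w (v 0) j) .numCandidates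
            (.and (.lt (.voteEntry (.weaken (.var 0)) (.var 0)) .numCandidates)
              (.forallLt (p := fun w i v =>
                  ¬ voteEntry w (Fin.tail v 0) i = voteEntry w (Fin.tail v 0) (v 0)) (.var 0)
                (.not (.eq (.voteEntry (.weaken (.weaken (.var 0))) (.var 0))
                  (.voteEntry (.weaken (.weaken (.var 0))) (.weaken (.var 0)))))))))
        (.eqInput (.instanceWord .recodedVotes))))

open Classical in
theorem Emit.kernelWord (p : Polynomial ℕ) :
    Emit tick (fun w (_ : Fin n → ℕ) => kernelWord p w) :=
  .ite (.isInstanceWord p) (.instanceWord .reducedWord) (.replicate mark .numCandidates)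

end StackProgram

/-! ### The kernelization -/

open Classical in
/-- The kernelization: an instance is reduced, and any other string becomes the empty string. -/
noncomputable def kernelize (p : Polynomial ℕ) (q : List CMSym × ℕ) : List CMSym × ℕ :=
  (if h : ∃ I : CMInstance q.2, I.encode = q.1 ∧ I.manipulators ≤ p.eval q.2 then
    h.choose.reduce.encode else [], q.2)

theorem kernelize_encode {m : ℕ} {p : Polynomial ℕ} (I : CMInstance m)
    (hI : I.manipulators ≤ p.eval m) : kernelize p (I.encode, m) = (I.reduce.encode, m) := by
  have h : ∃ J : CMInstance m, J.encode = I.encode ∧ J.manipulators ≤ p.eval m := ⟨I, rfl, hI⟩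
  rw [kernelize, dif_pos h, CMInstance.encode_injective h.choose_spec.1]

/-- The link between the emitted word and the abstract map, covering malformed input as well. -/
theorem encode_kernelize (p : Polynomial ℕ) (q : List CMSym × ℕ) :
    kernelWord p ((pairEncoding CMSym).encode q) =
      (pairEncoding CMSym).encode (kernelize p q) := by
  obtain ⟨x, k⟩ := q
  by_cases h : ∃ I : CMInstance k, I.encode = x ∧ I.manipulators ≤ p.eval k
  · obtain ⟨I, rfl, hI⟩ := h
    rw [kernelWord_encode p I hI, kernelize_encode I hI]
  · rw [kernelWord_of_not_exists h, kernelize, dif_neg h]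

/-! ### Length of encodings and the kernelization theorem. -/

theorem length_encodeRow (l : List ℕ) : (encodeRow l).length = l.sum + l.length + 1 := by
  induction l with
  | nil => rfl
  | cons a l ih =>
    simp only [encodeRow, List.length_append, List.flatMap_cons, List.length_replicate,
      List.sum_cons, List.length_cons, List.length_nil] at ih ⊢
    omega

theorem CMInstance.length_encode_le {m : ℕ} (I : CMInstance m) :
    I.encode.length ≤ 2 * m + 3 + I.numVotes * (m * m + 1) := by
  have h₁ : (encodeRow [m, (I.target : ℕ)]).length ≤ 2 * m + 3 := by
    have := I.target.2
    rw [length_encodeRow]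
    simp
    omega
  have h₂ (v : Vote m) : (encodeRow (List.ofFn fun i => (v i : ℕ))).length ≤ m * m + 1 := by
    rw [length_encodeRow, List.sum_ofFn, List.length_ofFn]
    -- Each entry is counted together with its comma; being below `m`, it takes at most `m` symbols.
    have : ∑ i, ((v i : ℕ) + 1) ≤ ∑ _i : Fin m, m := Finset.sum_le_sum fun i _ => (v i).2
    simp only [Finset.sum_add_distrib, Finset.sum_const, Finset.card_univ, Fintype.card_fin,
      smul_eq_mul, mul_one] at this
    omega
  have h₃ := length_flatMap_le I.votes _ _ h₂
  have h₄ : I.manipulators ≤ I.manipulators * (m * m + 1) := Nat.le_mul_of_pos_right _ (by omega)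
  have h₅ : (List.replicate I.manipulators (encodeRow [])).flatten.length = I.manipulators := by
    simp [encodeRow]
  rw [CMInstance.encode, List.length_append, List.length_append, h₅, CMInstance.numVotes, add_mul]
  omega

theorem isPolynomialKernelization_kernelize (p : Polynomial ℕ) :
    IsPolynomialKernelization (CopelandCM p) (kernelize p) where
  polyTime := (Emit.kernelWord p).polyTime _ _ _ fun q => encode_kernelize p q
  equivalent := by
    rintro ⟨x, k⟩
    by_cases h : ∃ I : CMInstance k, I.encode = x ∧ I.manipulators ≤ p.eval k
    · obtain ⟨I, rfl, hI⟩ := h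
      rw [kernelize_encode I hI]
      constructor
      · rintro ⟨J, hJ, -, hyes⟩
        have e : J = I := CMInstance.encode_injective hJ
        exact ⟨I.reduce, rfl, hI, I.isYes_reduce.2 (e ▸ hyes)⟩
      · rintro ⟨J, hJ, -, hyes⟩
        have e : J = I.reduce := CMInstance.encode_injective hJ
        exact ⟨I, rfl, hI, I.isYes_reduce.1 (e ▸ hyes)⟩
    · rw [kernelize, dif_neg h]
      constructor
      · rintro ⟨I, hI, hman, -⟩
        exact absurd ⟨I, hI, hman⟩ h
      · rintro ⟨I, hI, -, -⟩
        -- No instance has the empty string as its encoding, so the default output is a no-instance.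
        simp [CMInstance.encode, encodeRow] at hI
  size := by
    -- The encoding bound with the bound on votes inserted; `1 + p` replaces `max 1 t`, which is not
    -- a polynomial.
    refine ⟨2 * .X + 3 + 7 * (.X ^ 2 * (1 + p)) * (.X * .X + 1), fun x k => ⟨?_, ?_⟩⟩
    · by_cases h : ∃ I : CMInstance k, I.encode = x ∧ I.manipulators ≤ p.eval k
      · obtain ⟨I, rfl, hI⟩ := h
        rw [kernelize_encode I hI]
        refine I.reduce.length_encode_le.trans ?_
        have h₁ : I.reduce.numVotes ≤ 7 * (k ^ 2 * (1 + p.eval k)) := by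
          refine I.numVotes_reduce_le.trans ?_
          gcongr
          omega
        simp only [Polynomial.eval_add, Polynomial.eval_mul, Polynomial.eval_X,
          Polynomial.eval_pow, Polynomial.eval_one, Polynomial.eval_ofNat]
        gcongr
      · rw [kernelize, dif_neg h]
        simp
    · simp [kernelize]
      nlinarith [Nat.zero_le (7 * (k ^ 2 * (1 + p.eval k)) * (k * k + 1))]

theorem theorem8 :
    ∃ C : ℕ, ∀ p : Polynomial ℕ,
      ∃ f : List CMSym × ℕ → List CMSym × ℕ,
        IsPolynomialKernelization (CopelandCM p) f ∧
        ∀ (m : ℕ) (I : CMInstance m), I.manipulators ≤ p.eval m →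
          ∃ J : CMInstance m,
            f (I.encode, m) = (J.encode, m) ∧
            J.target = I.target ∧
            J.manipulators = I.manipulators ∧
            (∀ x y : Fin m,
              margin J.votes x y = capWeight I.manipulators (margin I.votes x y)) ∧
            J.numVotes ≤ C * (m ^ 2 * max 1 I.manipulators) := by
  exact ⟨7, fun p => ⟨kernelize p, isPolynomialKernelization_kernelize p, fun m I hI =>
    ⟨I.reduce, kernelize_encode I hI, rfl, rfl, margin_reducedVotes _ _, I.numVotes_reduce_le⟩⟩⟩
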